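/- Let $1\le\nu<m\le k$ be integers, let $0<\alpha<1$, and let $\hat\beta_1,\dots,\hat\beta_k$ be independent with $\hat\beta_i\sim N(\beta_i,\sigma^2)$, where $\beta=(\beta_1,\dots,\beta_k)\in\mathbb R^k$ and the nuisance parameter $\sigma>0$ are unknown; write $P_{\beta,\sigma}$ for their joint law. Let $X_1\le\dots\le X_k$ be the order statistics of $\hat\beta_1^2,\dots,\hat\beta_k^2$, and for an integer $n$ with $\nu\le n\le m$ put $S_n=X_1+\dots+X_n$ and $W_{n,m}=nX_m/S_n$. Let $H_{0,m}$ be the null hypothesis that at least $m$ of the $\beta_i$ are zero. Let $Y_{1,m}\le\dots\le Y_{m,m}$ be the order statistics of the squares of $m$ independent $N(0,\sigma^2)$ variables and put $Z_{n,m}=nY_{m,m}/\sum_{i=1}^n Y_{i,m}$. (Corollary 1.) For every integer $n$ with $\nu\le n\le m$, the distribution of $Z_{n,m}$ does not depend on $\sigma$; there is a number $d_{n,m}$ with $P(Z_{n,m}>d_{n,m})=\alpha$ (the upper-$\alpha$ percentile of $Z_{n,m}$); and for every such $d_{n,m}$ the rejection region $R_{n,m}=\{W_{n,m}>d_{n,m}\}$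 defines a level-$\alpha$ test of $H_{0,m}$, that is, for every $\sigma>0$, $$\sup_{\beta\in H_{0,m}}P_{\beta,\sigma}(W_{n,m}>d_{n,m})=\alpha .$$ (Theorem 2.) In particular, the regions $R_{\nu,m}=\{W_{\nu,m}>d_{\nu,m}\}$ (fixed scaling) and $R_{m-1,m}=\{W_{m-1,m}>d_{m-1,m}\}$ (sequential scaling) both define level-$\alpha$ tests of $H_{0,m}$. -/

import Mathlib

open MeasureTheory ProbabilityTheory

namespace StepUp

/-- The joint law `P_{β,σ}` of the effect estimators `β̂ = (β̂₁, …, β̂ₖ)`: independent coordinates,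
`β̂ᵢ ∼ N(βᵢ, σ²)`. -/
noncomputable def effectLaw {k : ℕ} (β : Fin k → ℝ) (σ : ℝ) : Measure (Fin k → ℝ) :=
  Measure.pi fun i => gaussianReal (β i) (σ ^ 2).toNNReal

/-- The `j`-th smallest entry of `y`, for `1 ≤ j ≤ k` (and `0` for other `j`). -/
noncomputable def orderStat {k : ℕ} (y : Fin k → ℝ) (j : ℕ) : ℝ :=
  if h : 1 ≤ j ∧ j ≤ k then y (Tuple.sort y ⟨j - 1, by omega⟩) else 0

/-- `X_j`: the `j`-th order statistic of the squares `β̂₁², …, β̂ₖ²`. -/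
noncomputable def X {k : ℕ} (b : Fin k → ℝ) (j : ℕ) : ℝ :=
  orderStat (fun i => b i ^ 2) j

/-- `S_n = X_1 + ⋯ + X_n`. -/
noncomputable def S {k : ℕ} (n : ℕ) (b : Fin k → ℝ) : ℝ :=
  ∑ j ∈ Finset.Icc 1 n, X b j

/-- The test statistic `W_{n,m} = n X_m / S_n`. -/
noncomputable def W {k : ℕ} (n m : ℕ) (b : Fin k → ℝ) : ℝ :=
  n * X b m / S n b

/-- `Z_{n,m} = n Y_{m,m} / (Y_{1,m} + ⋯ + Y_{n,m})`, where `Y_{1,m} ≤ ⋯ ≤ Y_{m,m}` are the order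
statistics of the squares of the `m` entries of `y`. It is used under `effectLaw 0 σ`. -/
noncomputable def Z {m : ℕ} (n : ℕ) (y : Fin m → ℝ) : ℝ :=
  n * X y m / ∑ j ∈ Finset.Icc 1 n, X y j

/-- `d` is an upper-`α` percentile of `Z_{n,m}`: `P(Z_{n,m} > d) = α`, where `Z_{n,m}` is built from
the squares of `m` independent standard normal variables. -/
def IsUpperPercentile (n m : ℕ) (α d : ℝ) : Prop :=
  (effectLaw (0 : Fin m → ℝ) 1).real {y | Z n y > d} = α

/-- The number `N` of effects that equal zero. -/
noncomputable def numZero {k : ℕ} (β : Fin k → ℝ) : ℕ :=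
  (Finset.univ.filter fun i => β i = 0).card

/-- The null hypothesis `H_{0,m} : N ≥ m`. -/
def H0 (k m : ℕ) : Set (Fin k → ℝ) :=
  {β | m ≤ numZero β}

/-- The rejection region `R_{n,m} = {W_{n,m} > d}`. -/
def R (k n m : ℕ) (d : ℝ) : Set (Fin k → ℝ) :=
  {b | W n m b > d}

/-- The event `A` is the rejection region of a level-`α` test of the null hypothesis `H`: whatever
the nuisance parameter `σ > 0`, the supremum over `β ∈ H` of the rejection probability is `α`
(in particular, each of these probabilities is at most `α`). -/
def IsLevelTest {k : ℕ} (H : Set (Fin k → ℝ)) (A : Set (Fin k → ℝ)) (α : ℝ) : Prop :=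
  MeasurableSet A ∧
    ∀ σ : ℝ, 0 < σ → IsLUB ((fun β => (effectLaw β σ).real A) '' H) α

end StepUp

/-!
The statistic `W n m b` depends only on the `m` coordinates of `b` that are smallest in absolute
value. Almost surely there are no ties, and the sample space splits into cells according to the set
`A` of these `m` indices and the index `i ∈ A` at which the largest of them, `s = |b i| = √X_m`, is
attained. Given the cell and `b i`, the other entries of `A` are independent normal variables
truncated to `(-s, s)`, and by homogeneity the event `W > d` only concerns the entries divided by
`s`, on which it is decreasing in every absolute value.

The key estimate is `lintegral_truncScaled_le`: for `s ≤ t`, an `N(a, v)` variable truncated to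
`(-s, s)` and divided by `s` is stochastically larger in absolute value than an `N(0, v)` variable
truncated to `(-t, t)` and divided by `t`. The densities of the two absolute values on `(0, 1)` have
the ratio `exp (c x²) * cosh (c' x)` with `0 ≤ c`, up to a constant factor, which is increasing, and
a symmetrized double integral (`lintegral_mul_lintegral_le_of_antivary`) gives the comparison.
Coordinate by coordinate this bounds the conditional rejection probability by `condTail s`, the
conditional tail of the null statistic `Z` given that its largest absolute value is `s`; the same
estimate shows that `condTail` is monotone.

Summing over the cells, `P(W > d) ≤ E[condTail √X_m]`, with equality if all means vanish. If `β`
vanishes at `m` indices, then `X_m` is at most the largest square at these indices, so monotonicity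
gives `P(W > d) ≤ E[condTail √Y_m] = P(Z > d)` (`measure_exceedSet_le_null`). The bound is sharp
because letting all the other means tend to infinity makes `W` agree with `Z` of the `m` null
coordinates (`tendsto_effectLaw_farEffects`).

Scale invariance of `Z` removes `σ`. The law of `Z` has no atoms, because `Z = d` forces one of
finitely many nonzero diagonal quadratic forms to vanish; so its distribution function is continuous
and every tail probability in `(0, 1)` is attained.
-/

namespace StepUp

open scoped ENNReal NNReal

/-! ### Order statistics and the test statistic -/

/-- Counting characterization of the order statistics, the source of their monotonicity, homogeneity
and measurability. -/
theorem orderStat_le_iff {k : ℕ} (y : Fin k → ℝ) {j : ℕ} (h1 : 1 ≤ j) (hk : j ≤ k) (t : ℝ) :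
    orderStat y j ≤ t ↔ j ≤ (Finset.univ.filter fun i => y i ≤ t).card := by
  have hcard : (Finset.univ.filter fun i => y i ≤ t).card
      = (Finset.univ.filter fun i => (y ∘ Tuple.sort y) i ≤ t).card := by
    symm
    apply Finset.card_bij (fun i _ => Tuple.sort y i)
    · intro a ha; simpa using ha
    · intro a _ b _ h; exact (Tuple.sort y).injective h
    · intro b hb
      exact ⟨(Tuple.sort y).symm b, by simpa using hb, by simp⟩
  have h := Tuple.lt_card_le_iff_apply_le_of_monotone (a := t) (j := ⟨j - 1, by omega⟩)
    (Tuple.monotone_sort y)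
  rw [orderStat, dif_pos ⟨h1, hk⟩, hcard]
  rw [Function.comp_apply] at h
  rw [← h]
  simp only [Function.comp_apply]
  omega

theorem orderStat_mono {k : ℕ} {y z : Fin k → ℝ} (h : ∀ i, y i ≤ z i) (j : ℕ) :
    orderStat y j ≤ orderStat z j := by
  by_cases hj : 1 ≤ j ∧ j ≤ k
  · rw [orderStat_le_iff y hj.1 hj.2]
    refine ((orderStat_le_iff z hj.1 hj.2 _).1 le_rfl).trans (Finset.card_le_card ?_)
    intro i hi
    simp only [Finset.mem_filter, Finset.mem_univ, true_and] at hi ⊢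
    exact (h i).trans hi
  · simp [orderStat, hj]

/-- The order statistics of a subsample are at least those of the whole sample. -/
theorem orderStat_le_comp {m k : ℕ} (y : Fin k → ℝ) (e : Fin m ↪ Fin k) {j : ℕ} (h1 : 1 ≤ j)
    (hj : j ≤ m) : orderStat y j ≤ orderStat (y ∘ e) j := by
  have hmk : m ≤ k := by simpa using Fintype.card_le_of_embedding e
  rw [orderStat_le_iff y h1 (hj.trans hmk)]
  refine ((orderStat_le_iff (y ∘ e) h1 hj _).1 le_rfl).trans ?_
  apply Finset.card_le_card_of_injOn e
  · intro i hi; simpa using hi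
  · exact e.injective.injOn

/-- Entries outside the range of `e` that are at least as large as all entries in the range do not
affect the `m` smallest order statistics. -/
theorem orderStat_comp {m k : ℕ} (y : Fin k → ℝ) (e : Fin m ↪ Fin k)
    (h : ∀ l, l ∉ Set.range e → ∀ i, y (e i) ≤ y l) {j : ℕ} (hj : j ≤ m) :
    orderStat (y ∘ e) j = orderStat y j := by
  have hmk : m ≤ k := by simpa using Fintype.card_le_of_embedding e
  rcases Nat.eq_zero_or_pos j with rfl | h1
  · simp [orderStat]
  refine le_antisymm ?_ (orderStat_le_comp y e h1 hj)
  rw [orderStat_le_iff _ h1 hj]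
  set t := orderStat y j
  have ht := (orderStat_le_iff y h1 (hj.trans hmk) t).1 le_rfl
  by_cases hex : ∃ l, l ∉ Set.range e ∧ y l ≤ t
  · obtain ⟨l, hl, hlt⟩ := hex
    rw [Finset.filter_true_of_mem (p := fun i => (y ∘ e) i ≤ t)
      fun i _ => (h l hl i).trans hlt]
    simpa using hj
  · push Not at hex
    refine ht.trans ?_
    rw [← Finset.card_map e]
    apply Finset.card_le_card
    intro l hl
    simp only [Finset.mem_filter, Finset.mem_univ, true_and] at hl
    by_cases hr : l ∈ Set.range e
    · obtain ⟨i, rfl⟩ := hr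
      simpa using hl
    · exact absurd hl (not_le.2 (hex l hr))

theorem orderStat_smul {k : ℕ} (y : Fin k → ℝ) {c : ℝ} (hc : 0 < c) (j : ℕ) :
    orderStat (fun i => c * y i) j = c * orderStat y j := by
  by_cases hj : 1 ≤ j ∧ j ≤ k
  · refine eq_of_forall_ge_iff fun t => ?_
    rw [orderStat_le_iff _ hj.1 hj.2, mul_comm c, ← le_div_iff₀ hc,
      orderStat_le_iff _ hj.1 hj.2]
    simp only [le_div_iff₀ hc, mul_comm c]
  · simp [orderStat, hj]

theorem orderStat_last {p : ℕ} (y : Fin (p + 1) → ℝ) {i : Fin (p + 1)} (h : ∀ l, y l ≤ y i) :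
    orderStat y (p + 1) = y i := by
  refine eq_of_forall_ge_iff fun t => ?_
  rw [orderStat_le_iff _ (by omega) le_rfl]
  constructor
  · intro hc
    have : (Finset.univ.filter fun i => y i ≤ t) = Finset.univ := by
      apply Finset.eq_univ_of_card
      refine le_antisymm (Finset.card_le_univ _) (by simpa using hc)
    have := this ▸ Finset.mem_univ i
    simpa using this
  · intro hi
    rw [Finset.filter_true_of_mem fun l _ => (h l).trans hi]
    simp

theorem measurable_orderStat {k : ℕ} (j : ℕ) : Measurable fun y : Fin k → ℝ => orderStat y j := by
  by_cases hj : 1 ≤ j ∧ j ≤ k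
  · refine measurable_of_Iic fun t => ?_
    have : (fun y : Fin k → ℝ => orderStat y j) ⁻¹' Set.Iic t
        = {y | j ≤ ∑ i, if y i ≤ t then 1 else 0} := by
      ext y
      simp only [Set.mem_preimage, Set.mem_Iic, Set.mem_ofPred_eq]
      rw [orderStat_le_iff y hj.1 hj.2, Finset.card_filter]
    rw [this]
    refine measurableSet_le measurable_const (Finset.measurable_sum _ fun i _ => ?_)
    exact Measurable.ite (measurableSet_le (measurable_pi_apply i) measurable_const)
      measurable_const measurable_const
  · simp [orderStat, hj]

theorem exists_eq_orderStat {k : ℕ} (y : Fin k → ℝ) {j : ℕ} (h1 : 1 ≤ j) (hj : j ≤ k) :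
    orderStat y j = y (Tuple.sort y ⟨j - 1, by omega⟩) := dif_pos ⟨h1, hj⟩

theorem measurable_X {k : ℕ} (j : ℕ) : Measurable fun b : Fin k → ℝ => X b j :=
  (measurable_orderStat j).comp (by fun_prop)

theorem measurable_S {k : ℕ} (n : ℕ) : Measurable (S n : (Fin k → ℝ) → ℝ) :=
  Finset.measurable_sum _ fun j _ => measurable_X j

theorem measurable_W {k : ℕ} (n m : ℕ) : Measurable (W n m : (Fin k → ℝ) → ℝ) :=
  ((measurable_X m).const_mul _).div (measurable_S n)

theorem Z_eq_W {m : ℕ} (n : ℕ) (y : Fin m → ℝ) : Z n y = W n m y := rfl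

theorem X_nonneg {k : ℕ} (b : Fin k → ℝ) (j : ℕ) : 0 ≤ X b j := by
  unfold X orderStat
  split_ifs
  · positivity
  · exact le_rfl

theorem S_nonneg {k : ℕ} (n : ℕ) (b : Fin k → ℝ) : 0 ≤ S n b :=
  Finset.sum_nonneg fun j _ => X_nonneg b j

theorem W_nonneg {k : ℕ} (n m : ℕ) (b : Fin k → ℝ) : 0 ≤ W n m b :=
  div_nonneg (mul_nonneg (Nat.cast_nonneg _) (X_nonneg b m)) (S_nonneg n b)

theorem S_pos {k n : ℕ} (hn : 1 ≤ n) (hnk : n ≤ k) {b : Fin k → ℝ} (hb : ∀ i, b i ≠ 0) :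
    0 < S n b := by
  refine Finset.sum_pos (fun j hj => ?_) ⟨1, by simpa using hn⟩
  rw [Finset.mem_Icc] at hj
  rw [X, exists_eq_orderStat _ hj.1 (hj.2.trans hnk)]
  exact sq_pos_of_ne_zero (hb _)

theorem S_mono {k n : ℕ} {b c : Fin k → ℝ} (h : ∀ i, |b i| ≤ |c i|) : S n b ≤ S n c :=
  Finset.sum_le_sum fun j _ => orderStat_mono (fun i => sq_le_sq.2 (h i)) j

theorem X_smul {k : ℕ} (b : Fin k → ℝ) {c : ℝ} (hc : c ≠ 0) (j : ℕ) :
    X (fun i => c * b i) j = c ^ 2 * X b j := by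
  unfold X
  simp only [mul_pow]
  exact orderStat_smul _ (by positivity) j

theorem S_smul {k : ℕ} (n : ℕ) (b : Fin k → ℝ) {c : ℝ} (hc : c ≠ 0) :
    S n (fun i => c * b i) = c ^ 2 * S n b := by
  simp only [S, X_smul _ hc, Finset.mul_sum]

theorem W_smul {k : ℕ} (n m : ℕ) (b : Fin k → ℝ) {c : ℝ} (hc : c ≠ 0) :
    W n m (fun i => c * b i) = W n m b := by
  rw [W, W, X_smul _ hc, S_smul _ _ hc, mul_left_comm, mul_div_mul_left _ _ (pow_ne_zero 2 hc)]

theorem X_comp {m k : ℕ} (b : Fin k → ℝ) (e : Fin m ↪ Fin k)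
    (h : ∀ l, l ∉ Set.range e → ∀ i, |b (e i)| ≤ |b l|) {j : ℕ} (hj : j ≤ m) :
    X (b ∘ e) j = X b j :=
  orderStat_comp (fun i => b i ^ 2) e (fun l hl i => sq_le_sq.2 (h l hl i)) hj

theorem S_comp {m k n : ℕ} (hn : n ≤ m) (b : Fin k → ℝ) (e : Fin m ↪ Fin k)
    (h : ∀ l, l ∉ Set.range e → ∀ i, |b (e i)| ≤ |b l|) : S n (b ∘ e) = S n b :=
  Finset.sum_congr rfl fun _ hj => X_comp b e h ((Finset.mem_Icc.1 hj).2.trans hn)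

theorem W_comp {m k n : ℕ} (hn : n ≤ m) (b : Fin k → ℝ) (e : Fin m ↪ Fin k)
    (h : ∀ l, l ∉ Set.range e → ∀ i, |b (e i)| ≤ |b l|) : W n m (b ∘ e) = W n m b := by
  rw [W, W, X_comp b e h le_rfl, S_comp hn b e h]

/-! ### Truncated normal variables -/

/-- The rearrangement inequality in `ℝ≥0∞`, where subtraction is not available. -/
theorem ennreal_rearrangement {a b c d : ℝ≥0∞} (hab : a ≤ b) (hcd : c ≤ d) :
    a * d + b * c ≤ a * c + b * d := by
  obtain ⟨e, rfl⟩ := exists_add_of_le hab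
  obtain ⟨f, rfl⟩ := exists_add_of_le hcd
  calc a * (c + f) + (a + e) * c ≤ a * (c + f) + (a + e) * c + e * f := le_self_add
    _ = a * c + (a + e) * (c + f) := by ring

/-- Chebyshev's integral inequality for two densities `f₁`, `f₂`: the hypothesis says that `h` and the
likelihood ratio `f₁ / f₂` vary in opposite directions. -/
theorem lintegral_mul_lintegral_le_of_antivary {α : Type*} [MeasurableSpace α] (ρ : Measure α)
    [SFinite ρ] {h f₁ f₂ : α → ℝ≥0∞} (hh : Measurable h) (hf₁ : Measurable f₁)
    (hf₂ : Measurable f₂)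
    (H : ∀ u w, h u * (f₁ u * f₂ w) + h w * (f₂ u * f₁ w)
      ≤ h u * (f₂ u * f₁ w) + h w * (f₁ u * f₂ w)) :
    (∫⁻ u, h u * f₁ u ∂ρ) * ∫⁻ u, f₂ u ∂ρ ≤ (∫⁻ u, h u * f₂ u ∂ρ) * ∫⁻ u, f₁ u ∂ρ := by
  have key : ∀ {a b : α → ℝ≥0∞}, Measurable a → Measurable b →
      ∫⁻ u, ∫⁻ w, (h u * (a u * b w) + h w * (b u * a w)) ∂ρ ∂ρ
        = 2 * ((∫⁻ u, h u * a u ∂ρ) * ∫⁻ u, b u ∂ρ) := by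
    intro a b ha hb
    have : ∀ u, ∫⁻ w, (h u * (a u * b w) + h w * (b u * a w)) ∂ρ
        = h u * a u * ∫⁻ w, b w ∂ρ + b u * ∫⁻ w, h w * a w ∂ρ := by
      intro u
      rw [lintegral_add_left (by fun_prop), ← lintegral_const_mul _ hb,
        ← lintegral_const_mul _ (by fun_prop)]
      congr 1 <;> refine lintegral_congr fun w => ?_ <;> ring
    simp_rw [this]
    rw [lintegral_add_left (by fun_prop), lintegral_mul_const _ (by fun_prop),
      lintegral_mul_const _ hb]
    ring
  -- Symmetrizing the double integral in its two variables makes the inequality hold pointwise.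
  have h2 : 2 * ((∫⁻ u, h u * f₁ u ∂ρ) * ∫⁻ u, f₂ u ∂ρ)
      ≤ 2 * ((∫⁻ u, h u * f₂ u ∂ρ) * ∫⁻ u, f₁ u ∂ρ) := by
    rw [← key hf₁ hf₂, ← key hf₂ hf₁]
    exact lintegral_mono fun u => lintegral_mono fun w => H u w
  exact (ENNReal.mul_le_mul_iff_right (by simp) (by simp)).1 h2

/-- The function `h` does not increase when the absolute value of its argument increases. -/
def AbsAntitone (h : ℝ → ℝ≥0∞) : Prop :=
  ∀ ⦃x y : ℝ⦄, |x| ≤ |y| → h y ≤ h x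

theorem AbsAntitone.neg {h : ℝ → ℝ≥0∞} (H : AbsAntitone h) (x : ℝ) : h (-x) = h x :=
  le_antisymm (H (by simp)) (H (by simp))

/-- The symmetrized normal density; as integrands are even, only this average over the sign of the
mean matters. -/
theorem gaussianPDFReal_add_neg (a : ℝ) (v : ℝ≥0) (x : ℝ) :
    gaussianPDFReal a v x + gaussianPDFReal (-a) v x
      = 2 * (√(2 * Real.pi * v))⁻¹ * Real.exp (-(a ^ 2) / (2 * v))
        * (Real.exp (-(x ^ 2) / (2 * v)) * Real.cosh (a * x / v)) := by
  have e1 : -(x - a) ^ 2 / (2 * (v : ℝ)) = -(a ^ 2) / (2 * v) + -(x ^ 2) / (2 * v) + a * x / v := by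
    ring
  have e2 : -(x - -a) ^ 2 / (2 * (v : ℝ))
      = -(a ^ 2) / (2 * v) + -(x ^ 2) / (2 * v) + -(a * x / v) := by
    ring
  rw [gaussianPDFReal, gaussianPDFReal, e1, e2, Real.exp_add _ (a * x / v),
    Real.exp_add _ (-(a * x / v)), Real.exp_add, Real.cosh_eq]
  ring

/-- Monotone likelihood ratio of the symmetrized normal densities. -/
theorem gaussianPDFReal_symm_mul_le {a : ℝ} {v w : ℝ≥0} (hw : w ≠ 0) (hwv : w ≤ v) {x y : ℝ}
    (hxy : |x| ≤ |y|) :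
    (gaussianPDFReal a v x + gaussianPDFReal (-a) v x) * gaussianPDFReal 0 w y
      ≤ gaussianPDFReal 0 w x * (gaussianPDFReal a v y + gaussianPDFReal (-a) v y) := by
  have hw0 : (0 : ℝ) < w := by positivity
  have hwv' : (w : ℝ) ≤ v := by exact_mod_cast hwv
  have hv0 : (0 : ℝ) < v := hw0.trans_le hwv'
  rw [gaussianPDFReal_add_neg, gaussianPDFReal_add_neg, gaussianPDFReal, gaussianPDFReal]
  simp only [sub_zero]
  have hsq : x ^ 2 ≤ y ^ 2 := sq_le_sq.2 hxy
  have hc : Real.cosh (a * x / v) ≤ Real.cosh (a * y / v) := by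
    rw [Real.cosh_le_cosh, abs_div, abs_div, abs_mul, abs_mul]
    gcongr
  have he : Real.exp (-(x ^ 2) / (2 * v)) * Real.exp (-(y ^ 2) / (2 * w))
      ≤ Real.exp (-(x ^ 2) / (2 * w)) * Real.exp (-(y ^ 2) / (2 * v)) := by
    rw [← Real.exp_add, ← Real.exp_add, Real.exp_le_exp]
    have : 0 ≤ (y ^ 2 - x ^ 2) * (1 / (2 * w) - 1 / (2 * v)) := by
      refine mul_nonneg (by linarith) (sub_nonneg.2 ?_)
      gcongr
    have e : -(x ^ 2) / (2 * (w : ℝ)) + -(y ^ 2) / (2 * v) - (-(x ^ 2) / (2 * v) + -(y ^ 2) / (2 * w))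
      = (y ^ 2 - x ^ 2) * (1 / (2 * w) - 1 / (2 * v)) := by ring
    linarith
  have hch : 0 ≤ Real.cosh (a * x / v) := (Real.cosh_pos _).le
  have := mul_le_mul he hc hch (by positivity)
  have hC : 0 ≤ 2 * (√(2 * Real.pi * v))⁻¹ * Real.exp (-(a ^ 2) / (2 * v))
    * (√(2 * Real.pi * w))⁻¹ := by positivity
  have := mul_le_mul_of_nonneg_left this hC
  calc _ = _ := by ring
    _ ≤ _ := this
    _ = _ := by ring

theorem gaussianReal_Ioo_pos (a : ℝ) {v : ℝ≥0} (hv : v ≠ 0) {s : ℝ} (hs : 0 < s) :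
    gaussianReal a v (Set.Ioo (-s) s) ≠ 0 := by
  intro h
  have := gaussianReal_absolutelyContinuous' a hv h
  simp at this
  linarith

/-- Integrals of even functions over symmetric intervals do not see the sign of the mean. -/
theorem setLIntegral_neg_mean (a : ℝ) (v : ℝ≥0) {h : ℝ → ℝ≥0∞} (hm : Measurable h)
    (hh : AbsAntitone h) (s : ℝ) :
    ∫⁻ x in Set.Ioo (-s) s, h x ∂(gaussianReal (-a) v)
      = ∫⁻ x in Set.Ioo (-s) s, h x ∂(gaussianReal a v) := by
  rw [← gaussianReal_map_neg, setLIntegral_map measurableSet_Ioo hm measurable_neg]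
  simp [hh.neg]

/-- On a symmetric interval, an `N(a, v)` variable is stochastically larger in absolute value than an
`N(0, w)` variable if `w ≤ v`. -/
theorem lintegral_cond_gaussianReal_le (a : ℝ) {v w : ℝ≥0} (hw : w ≠ 0) (hwv : w ≤ v)
    {s : ℝ} (hs : 0 < s)
    {h : ℝ → ℝ≥0∞} (hm : Measurable h) (hh : AbsAntitone h) :
    ∫⁻ x, h x ∂(cond (gaussianReal a v) (Set.Ioo (-s) s))
      ≤ ∫⁻ x, h x ∂(cond (gaussianReal 0 w) (Set.Ioo (-s) s)) := by
  have hv : v ≠ 0 := by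
    rintro rfl; exact hw (le_antisymm hwv zero_le)
  set A := Set.Ioo (-s) s
  set f₁ : ℝ → ℝ≥0∞ := fun x =>
    ENNReal.ofReal (gaussianPDFReal a v x + gaussianPDFReal (-a) v x)
  set f₂ : ℝ → ℝ≥0∞ := gaussianPDF 0 w
  have hf₁ : Measurable f₁ := by
    have := measurable_gaussianPDFReal a v
    have := measurable_gaussianPDFReal (-a) v
    fun_prop
  have hf₂ : Measurable f₂ := measurable_gaussianPDF 0 w
  have H : ∀ u w, h u * (f₁ u * f₂ w) + h w * (f₂ u * f₁ w)
      ≤ h u * (f₂ u * f₁ w) + h w * (f₁ u * f₂ w) := by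
    have hle : ∀ u w, |u| ≤ |w| → f₁ u * f₂ w ≤ f₂ u * f₁ w := by
      intro x y hxy
      simp only [f₁, f₂, gaussianPDF]
      rw [← ENNReal.ofReal_mul
          (add_nonneg (gaussianPDFReal_nonneg _ _ _) (gaussianPDFReal_nonneg _ _ _)),
        ← ENNReal.ofReal_mul (gaussianPDFReal_nonneg _ _ _)]
      exact ENNReal.ofReal_le_ofReal (gaussianPDFReal_symm_mul_le hw hwv hxy)
    intro u w
    rcases le_total |u| |w| with huw | huw
    · have := ennreal_rearrangement (hh huw) (hle u w huw)
      rw [add_comm, add_comm (h u * _)]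
      exact this
    · have := ennreal_rearrangement (hh huw) (hle w u huw)
      rw [mul_comm (f₁ u), mul_comm (f₂ u)]
      exact this
  -- Chebyshev's inequality on `A`, with the masses of `A` as normalizing factors.
  have key := lintegral_mul_lintegral_le_of_antivary (volume.restrict A) hm hf₁ hf₂ H
  have i1 : ∀ g : ℝ → ℝ≥0∞, Measurable g → AbsAntitone g →
      ∫⁻ u in A, g u * f₁ u = 2 * ∫⁻ u in A, g u ∂(gaussianReal a v) := by
    intro g hg hga
    have e : ∀ b : ℝ, ∫⁻ u in A, g u ∂(gaussianReal b v) = ∫⁻ u in A, g u * gaussianPDF b v u := by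
      intro b
      rw [gaussianReal_of_var_ne_zero _ hv, setLIntegral_withDensity_eq_setLIntegral_mul _
        (measurable_gaussianPDF b v) hg measurableSet_Ioo]
      simp [A, mul_comm]
    rw [two_mul]
    nth_rewrite 1 [← setLIntegral_neg_mean a v hg hga s]
    rw [e, e, ← lintegral_add_left (f := fun u => g u * gaussianPDF (-a) v u)
      (hg.mul (measurable_gaussianPDF _ _))]
    refine lintegral_congr fun u => ?_
    simp only [f₁, gaussianPDF]
    rw [ENNReal.ofReal_add (gaussianPDFReal_nonneg _ _ _) (gaussianPDFReal_nonneg _ _ _)]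
    ring
  have i2 : ∀ g : ℝ → ℝ≥0∞, Measurable g →
      ∫⁻ u in A, g u * f₂ u = ∫⁻ u in A, g u ∂(gaussianReal 0 w) := by
    intro g hg
    rw [gaussianReal_of_var_ne_zero _ hw, setLIntegral_withDensity_eq_setLIntegral_mul _
      (measurable_gaussianPDF 0 w) hg measurableSet_Ioo]
    simp [A, mul_comm, f₂]
  have j1 := i1 (fun _ => 1) measurable_const (fun _ _ _ => le_rfl)
  have j2 := i2 (fun _ => 1) measurable_const
  simp only [one_mul, lintegral_const, Measure.restrict_apply_univ] at j1 j2
  rw [i1 h hm hh, i2 h hm, j1, j2, mul_assoc, mul_left_comm _ (2 : ℝ≥0∞),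
    ENNReal.mul_le_mul_iff_right (by simp) (by simp)] at key
  rw [ProbabilityTheory.cond, ProbabilityTheory.cond, lintegral_smul_measure,
    lintegral_smul_measure]
  have p1 := gaussianReal_Ioo_pos a hv hs
  have p2 := gaussianReal_Ioo_pos 0 hw hs
  simp only [smul_eq_mul]
  rw [mul_comm, ← div_eq_mul_inv, mul_comm, ← div_eq_mul_inv,
    ENNReal.div_le_iff p1 (measure_ne_top _ _), mul_comm, ← mul_div_assoc,
    ENNReal.le_div_iff_mul_le (Or.inl p2) (Or.inl (measure_ne_top _ _))]
  rw [mul_comm (gaussianReal a v A)]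
  exact key

/-- The conditional law of `x / s` given `|x| < s`, for `x` distributed as `μ`. Dividing before
conditioning keeps all these laws on the same interval `(-1, 1)`. -/
noncomputable def truncScaled (μ : Measure ℝ) (s : ℝ) : Measure ℝ :=
  cond (μ.map (· / s)) (Set.Ioo (-1) 1)

instance (μ : Measure ℝ) [IsFiniteMeasure μ] (s : ℝ) : SigmaFinite (truncScaled μ s) := by
  unfold truncScaled; infer_instance

/-- Truncating to a smaller interval, or moving the mean away from `0`, makes the rescaled truncated
normal variable stochastically larger in absolute value. -/
theorem lintegral_truncScaled_le (a : ℝ) {v : ℝ≥0} (hv : v ≠ 0) {s t : ℝ} (hs : 0 < s) (hst : s ≤ t)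
    {h : ℝ → ℝ≥0∞} (hm : Measurable h) (hh : AbsAntitone h) :
    ∫⁻ x, h x ∂(truncScaled (gaussianReal a v) s) ≤ ∫⁻ x, h x ∂(truncScaled (gaussianReal 0 v) t) := by
  rw [truncScaled, truncScaled, gaussianReal_map_div_const, gaussianReal_map_div_const, zero_div]
  have ht := hs.trans_le hst
  refine lintegral_cond_gaussianReal_le _ ?_ ?_ one_pos hm hh
  · refine div_ne_zero hv ?_
    rw [Ne, ← NNReal.coe_eq_zero]
    simpa using ht.ne'
  · rw [← NNReal.coe_le_coe]
    push_cast
    gcongr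

theorem setLIntegral_eq_mul_truncScaled (μ : Measure ℝ) [IsFiniteMeasure μ] {s : ℝ} (hs : 0 < s)
    {h : ℝ → ℝ≥0∞} (hm : Measurable h) :
    ∫⁻ x in Set.Ioo (-s) s, h x ∂μ
      = μ (Set.Ioo (-s) s) * ∫⁻ u, h (s * u) ∂(truncScaled μ s) := by
  have hpre : (· / s) ⁻¹' (Set.Ioo (-1 : ℝ) 1) = Set.Ioo (-s) s := by
    ext x
    simp [lt_div_iff₀ hs, div_lt_iff₀ hs]
  have hd : Measurable (fun x : ℝ => x / s) := by fun_prop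
  rw [truncScaled, ProbabilityTheory.cond, lintegral_smul_measure,
    setLIntegral_map measurableSet_Ioo (by fun_prop) hd, Measure.map_apply hd measurableSet_Ioo,
    hpre]
  simp only [mul_div_cancel₀ _ hs.ne', smul_eq_mul]
  rcases eq_or_ne (μ (Set.Ioo (-s) s)) 0 with h0 | h0
  · rw [h0, zero_mul, Measure.restrict_eq_zero.2 h0, lintegral_zero_measure]
  · rw [← mul_assoc, ENNReal.mul_inv_cancel h0 (measure_ne_top _ _), one_mul]

/-! ### Conditioning on the largest absolute value -/

section Marginal

variable {ι : Type*} [DecidableEq ι]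

/-- A marginal over `L` at `x` only sees the points that agree with `x` outside `L`. -/
theorem lmarginal_congr_fun (μ : ι → Measure ℝ) {L : Finset ι} {f g : (ι → ℝ) → ℝ≥0∞} {x : ι → ℝ}
    (h : ∀ b, (∀ i ∉ L, b i = x i) → f b = g b) : (∫⋯∫⁻_L, f ∂μ) x = (∫⋯∫⁻_L, g ∂μ) x := by
  refine lintegral_congr fun z => h _ fun i hi => ?_
  simp [Function.updateFinset, hi]

theorem lmarginal_const_mul_of_measurable (μ : ι → Measure ℝ) {L : Finset ι} (c : ℝ≥0∞)
    {f : (ι → ℝ) → ℝ≥0∞} (hf : Measurable f) (x : ι → ℝ) :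
    (∫⋯∫⁻_L, (fun b => c * f b) ∂μ) x = c * (∫⋯∫⁻_L, f ∂μ) x :=
  lintegral_const_mul _ (hf.comp measurable_updateFinset)

/-- Replacing independent coordinates by coordinates that are stochastically smaller in absolute
value increases the integral of a function that is antitone in all absolute values. -/
theorem lmarginal_le_of_absAntitone {κ₁ κ₂ : ι → Measure ℝ} [∀ i, SigmaFinite (κ₁ i)]
    [∀ i, SigmaFinite (κ₂ i)]
    (hκ : ∀ i, ∀ g : ℝ → ℝ≥0∞, Measurable g → AbsAntitone g → ∫⁻ x, g x ∂κ₁ i ≤ ∫⁻ x, g x ∂κ₂ i)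
    {h : (ι → ℝ) → ℝ≥0∞} (hm : Measurable h)
    (hh : ∀ u w : ι → ℝ, (∀ i, |u i| ≤ |w i|) → h w ≤ h u) (L : Finset ι) (x : ι → ℝ) :
    (∫⋯∫⁻_L, h ∂κ₁) x ≤ (∫⋯∫⁻_L, h ∂κ₂) x := by
  induction L using Finset.induction generalizing x with
  | empty => simp
  | insert l L hl ih =>
    rw [lmarginal_insert _ hm hl, lmarginal_insert _ hm hl]
    refine (lintegral_mono fun t => ih _).trans (hκ l _ ?_ ?_)
    · exact (hm.lmarginal κ₂).comp (measurable_update x)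
    · intro s t hst
      refine lintegral_mono fun z => hh _ _ fun i => ?_
      by_cases hi : i ∈ L
      · simp [Function.updateFinset, hi]
      · by_cases hil : i = l
        · subst hil; simpa [Function.updateFinset, hi] using hst
        · simp [Function.updateFinset, hi, hil]

/-- Conditioning independent coordinates on lying in `(-s, s)` and rescaling them by `s`. -/
theorem lmarginal_trunc (μ : ι → Measure ℝ) [∀ i, IsFiniteMeasure (μ i)] {s : ℝ} (hs : 0 < s)
    (L : Finset ι) {h : (ι → ℝ) → ℝ≥0∞} (hm : Measurable h) (x : ι → ℝ) :
    (∫⋯∫⁻_L, (fun b => (∏ l ∈ L, (Set.Ioo (-s) s).indicator 1 (b l)) * h b) ∂μ) x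
      = (∏ l ∈ L, μ l (Set.Ioo (-s) s))
        * (∫⋯∫⁻_L, (fun u => h fun i => s * u i) ∂(fun i => truncScaled (μ i) s))
            (fun i => x i / s) := by
  have hind : Measurable ((Set.Ioo (-s) s).indicator (1 : ℝ → ℝ≥0∞)) :=
    measurable_const.indicator measurableSet_Ioo
  have hprod : ∀ L : Finset ι, Measurable fun b : ι → ℝ =>
      ∏ l ∈ L, (Set.Ioo (-s) s).indicator (1 : ℝ → ℝ≥0∞) (b l) := fun L =>
    Finset.measurable_prod _ fun l _ => hind.comp (measurable_pi_apply l)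
  have hmul : ∀ (L : Finset ι) {h : (ι → ℝ) → ℝ≥0∞}, Measurable h → Measurable fun b : ι → ℝ =>
      (∏ l ∈ L, (Set.Ioo (-s) s).indicator (1 : ℝ → ℝ≥0∞) (b l)) * h b := fun L _ hm =>
    (hprod L).mul hm
  have hscale : ∀ {h : (ι → ℝ) → ℝ≥0∞}, Measurable h →
      Measurable fun u : ι → ℝ => h fun i => s * u i := fun hm => hm.comp (by fun_prop)
  induction L using Finset.induction generalizing h x with
  | empty => simp [mul_div_cancel₀ _ hs.ne']
  | insert l L hl ih =>
    -- Integrate out coordinate `l` first and absorb the result into the integrand.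
    set h' : (ι → ℝ) → ℝ≥0∞ := fun b =>
      ∫⁻ w, h (Function.update b l (s * w)) ∂(truncScaled (μ l) s)
    have hup : Measurable fun z : (ι → ℝ) × ℝ => Function.update z.1 l (s * z.2) := by
      refine measurable_pi_iff.2 fun i => ?_
      by_cases hi : i = l
      · subst hi; simp only [Function.update_self]; fun_prop
      · simp only [Function.update_of_ne hi]; fun_prop
    have hm' : Measurable h' := Measurable.lintegral_prod_right' (hm.comp hup)
    rw [lmarginal_insert' _ (hmul _ hm) hl, lmarginal_insert' _ (hscale hm) hl,
      Finset.prod_insert hl, mul_assoc]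
    have inner : (fun x : ι → ℝ => ∫⁻ t, (∏ i ∈ insert l L, (Set.Ioo (-s) s).indicator (1 : ℝ → ℝ≥0∞)
        (Function.update x l t i)) * h (Function.update x l t) ∂μ l)
        = fun x => μ l (Set.Ioo (-s) s) *
          ((∏ i ∈ L, (Set.Ioo (-s) s).indicator 1 (x i)) * h' x) := by
      funext x
      have : ∀ t, (∏ i ∈ insert l L, (Set.Ioo (-s) s).indicator (1 : ℝ → ℝ≥0∞)
          (Function.update x l t i)) * h (Function.update x l t)
          = (∏ i ∈ L, (Set.Ioo (-s) s).indicator 1 (x i)) *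
            (Set.Ioo (-s) s).indicator (fun t => h (Function.update x l t)) t := by
        intro t
        rw [Finset.prod_insert hl, Function.update_self]
        have : ∏ i ∈ L, (Set.Ioo (-s) s).indicator (1 : ℝ → ℝ≥0∞) (Function.update x l t i)
            = ∏ i ∈ L, (Set.Ioo (-s) s).indicator 1 (x i) := by
          refine Finset.prod_congr rfl fun i hi => ?_
          rw [Function.update_of_ne]
          rintro rfl; exact hl hi
        rw [this]
        by_cases ht : t ∈ Set.Ioo (-s) s <;> simp [ht]
      have hmu : Measurable fun t => h (Function.update x l t) := hm.comp (measurable_update x)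
      simp_rw [this]
      rw [lintegral_const_mul _ (hmu.indicator measurableSet_Ioo),
        lintegral_indicator measurableSet_Ioo, setLIntegral_eq_mul_truncScaled _ hs hmu]
      ring
    rw [inner, lmarginal_const_mul_of_measurable _ _ (hmul L hm'), ih hm']
    congr 3
    funext u
    refine lintegral_congr fun w => ?_
    congr 1
    funext i
    by_cases hi : i = l
    · subst hi; simp
    · simp [hi]

end Marginal

section Core

variable {p : ℕ}

/-- The indicator of the event that the statistic exceeds `d`, for effects scaled so that the largest
square equals `1`. -/
noncomputable def exceedOne (n : ℕ) (d : ℝ) (u : Fin (p + 1) → ℝ) : ℝ≥0∞ :=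
  {u | d * S n u < n}.indicator 1 u

theorem measurable_exceedOne (n : ℕ) (d : ℝ) :
    Measurable (exceedOne n d : (Fin (p + 1) → ℝ) → ℝ≥0∞) :=
  measurable_const.indicator (measurableSet_lt ((measurable_S n).const_mul d) measurable_const)

theorem exceedOne_anti {n : ℕ} {d : ℝ} (hd : 0 ≤ d) (u w : Fin (p + 1) → ℝ)
    (h : ∀ i, |u i| ≤ |w i|) : exceedOne n d w ≤ exceedOne n d u := by
  unfold exceedOne
  by_cases hw : w ∈ {u : Fin (p + 1) → ℝ | d * S n u < n}
  · have hu : u ∈ {u : Fin (p + 1) → ℝ | d * S n u < n} :=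
      (mul_le_mul_of_nonneg_left (S_mono h) hd).trans_lt hw
    rw [Set.indicator_of_mem hw, Set.indicator_of_mem hu]
    rfl
  · rw [Set.indicator_of_notMem hw]; exact zero_le

theorem exceedOne_congr_abs {n : ℕ} {d : ℝ} (hd : 0 ≤ d) {u w : Fin (p + 1) → ℝ}
    (h : ∀ i, |u i| = |w i|) : exceedOne n d u = exceedOne n d w :=
  le_antisymm (exceedOne_anti hd _ _ fun i => (h i).ge) (exceedOne_anti hd _ _ fun i => (h i).le)

/-- The conditional probability that the statistic of `p + 1` independent `N(0, v)` variables
exceeds `d`, given that the last variable has the largest absolute value and that this value is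
`s`; it is set to `0` for `s ≤ 0`. -/
noncomputable def condTail (p n : ℕ) (d : ℝ) (v : ℝ≥0) (s : ℝ) : ℝ≥0∞ :=
  if 0 < s then
    (∫⋯∫⁻_Finset.univ.erase (Fin.last p), exceedOne n d ∂(fun _ => truncScaled (gaussianReal 0 v) s))
      (fun _ => 1)
  else 0

theorem condTail_mono (p n : ℕ) {d : ℝ} (hd : 0 ≤ d) {v : ℝ≥0} (hv : v ≠ 0) :
    Monotone (condTail p n d v) := by
  intro s t hst
  unfold condTail
  by_cases hs : 0 < s
  · rw [if_pos hs, if_pos (hs.trans_le hst)]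
    exact lmarginal_le_of_absAntitone
      (fun _ g hg hga => lintegral_truncScaled_le 0 hv hs hst hg hga)
      (measurable_exceedOne n d) (exceedOne_anti hd) _ _
  · rw [if_neg hs]; exact zero_le

theorem isProbabilityMeasure_truncScaled (a : ℝ) {v : ℝ≥0} (hv : v ≠ 0) {s : ℝ} (hs : 0 < s) :
    IsProbabilityMeasure (truncScaled (gaussianReal a v) s) := by
  refine cond_isProbabilityMeasure ?_
  rw [gaussianReal_map_div_const]
  refine gaussianReal_Ioo_pos _ (div_ne_zero hv ?_) one_pos
  rw [Ne, ← NNReal.coe_eq_zero]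
  simpa using hs.ne'

/-- The indicator of the event that the last entry has strictly the largest absolute value. -/
noncomputable def lastMax (y : Fin (p + 1) → ℝ) : ℝ≥0∞ :=
  ∏ l ∈ Finset.univ.erase (Fin.last p),
    (Set.Ioo (-|y (Fin.last p)|) |y (Fin.last p)|).indicator 1 (y l)

theorem lastMax_eq (y : Fin (p + 1) → ℝ) :
    lastMax y = {y : Fin (p + 1) → ℝ | ∀ l, l ≠ Fin.last p → |y l| < |y (Fin.last p)|}.indicator 1 y
    := by
  by_cases h : ∀ l, l ≠ Fin.last p → |y l| < |y (Fin.last p)|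
  · rw [Set.indicator_of_mem (by exact h), lastMax, Pi.one_apply]
    refine Finset.prod_eq_one fun l hl => ?_
    rw [Set.indicator_of_mem, Pi.one_apply]
    exact abs_lt.1 (h l (Finset.ne_of_mem_erase hl))
  · rw [Set.indicator_of_notMem (by exact h), lastMax]
    push Not at h
    obtain ⟨l, hl, hle⟩ := h
    refine Finset.prod_eq_zero (Finset.mem_erase.2 ⟨hl, Finset.mem_univ l⟩)
      (Set.indicator_of_notMem ?_ _)
    exact fun hmem => absurd (abs_lt.2 hmem) (not_lt.2 hle)

theorem measurable_lastMax : Measurable (lastMax : (Fin (p + 1) → ℝ) → ℝ≥0∞) := by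
  have : (lastMax : (Fin (p + 1) → ℝ) → ℝ≥0∞) = {y : Fin (p + 1) → ℝ |
      ∀ l, l ≠ Fin.last p → |y l| < |y (Fin.last p)|}.indicator 1 := funext lastMax_eq
  rw [this]
  refine measurable_const.indicator ?_
  have : {y : Fin (p + 1) → ℝ | ∀ l, l ≠ Fin.last p → |y l| < |y (Fin.last p)|}
      = ⋂ l, ⋂ (_ : l ≠ Fin.last p), {y | |y l| < |y (Fin.last p)|} := by
    ext y; simp
  rw [this]
  exact MeasurableSet.iInter fun l => MeasurableSet.iInter fun _ =>
    measurableSet_lt (by fun_prop) (by fun_prop)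

/-- The indicator of the event that the statistic exceeds `d`, when the last entry is the largest in
absolute value. -/
noncomputable def exceedLast (n : ℕ) (d : ℝ) (y : Fin (p + 1) → ℝ) : ℝ≥0∞ :=
  {y : Fin (p + 1) → ℝ | d * S n y < n * y (Fin.last p) ^ 2}.indicator 1 y

theorem measurable_exceedLast (n : ℕ) (d : ℝ) :
    Measurable (exceedLast n d : (Fin (p + 1) → ℝ) → ℝ≥0∞) :=
  measurable_const.indicator
    (measurableSet_lt ((measurable_S n).const_mul d) (by fun_prop))

/-- The conditional form of an integral over the event that the last entry is the largest, given that
entry. -/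
theorem lmarginal_lastMax_mul (μ : Fin (p + 1) → Measure ℝ) [∀ i, IsFiniteMeasure (μ i)]
    {g h : (Fin (p + 1) → ℝ) → ℝ≥0∞} (hh : Measurable h) {y : Fin (p + 1) → ℝ}
    (hy : y (Fin.last p) ≠ 0)
    (hgh : ∀ b, b (Fin.last p) = y (Fin.last p) → g b = h b) :
    (∫⋯∫⁻_Finset.univ.erase (Fin.last p), (fun b => lastMax b * g b) ∂μ) y
      = (∏ l ∈ Finset.univ.erase (Fin.last p),
          μ l (Set.Ioo (-|y (Fin.last p)|) |y (Fin.last p)|))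
        * (∫⋯∫⁻_Finset.univ.erase (Fin.last p), (fun u => h fun i => |y (Fin.last p)| * u i)
            ∂(fun i => truncScaled (μ i) |y (Fin.last p)|)) (fun i => y i / |y (Fin.last p)|) := by
  rw [← lmarginal_trunc μ (abs_pos.2 hy) _ hh]
  refine lmarginal_congr_fun μ fun b hb => ?_
  have hb' := hb (Fin.last p) (by simp)
  rw [lastMax, hb', hgh b hb']

theorem lmarginal_lastMax_mul_exceedLast (n : ℕ) {d : ℝ} (hd : 0 ≤ d)
    (μ : Fin (p + 1) → Measure ℝ) [∀ i, IsFiniteMeasure (μ i)]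
    {y : Fin (p + 1) → ℝ} (hy : y (Fin.last p) ≠ 0) :
    (∫⋯∫⁻_Finset.univ.erase (Fin.last p), (fun b => lastMax b * exceedLast n d b) ∂μ) y
      = (∏ l ∈ Finset.univ.erase (Fin.last p),
          μ l (Set.Ioo (-|y (Fin.last p)|) |y (Fin.last p)|))
        * (∫⋯∫⁻_Finset.univ.erase (Fin.last p), exceedOne n d
            ∂(fun i => truncScaled (μ i) |y (Fin.last p)|)) (fun _ => 1) := by
  set s := |y (Fin.last p)|
  have hs : 0 < s := abs_pos.2 hy
  have hmeas : Measurable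
      ({y : Fin (p + 1) → ℝ | d * S n y < n * s ^ 2}.indicator (1 : (Fin (p + 1) → ℝ) → ℝ≥0∞)) :=
    measurable_const.indicator
      (measurableSet_lt ((measurable_S n).const_mul d) measurable_const)
  rw [lmarginal_lastMax_mul μ (g := exceedLast n d) hmeas hy]
  · congr 1
    refine lintegral_congr fun z => ?_
    have hone : ∀ u : Fin (p + 1) → ℝ,
        ({y : Fin (p + 1) → ℝ | d * S n y < n * s ^ 2}.indicator (1 : (Fin (p + 1) → ℝ) → ℝ≥0∞))
            (fun i => s * u i)
          = exceedOne n d u := by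
      intro u
      have hiff : (d * S n (fun i => s * u i) < n * s ^ 2) ↔ d * S n u < n := by
        rw [S_smul n u hs.ne', mul_left_comm, mul_comm (n : ℝ),
          mul_lt_mul_iff_right₀ (by positivity)]
      by_cases hu : d * S n u < n
      · rw [exceedOne, Set.indicator_of_mem (by exact hiff.2 hu), Set.indicator_of_mem (by exact hu)]
        rfl
      · rw [exceedOne, Set.indicator_of_notMem (by exact mt hiff.1 hu),
          Set.indicator_of_notMem (by exact hu)]
    refine (hone _).trans ?_
    -- The rescaled last entry is `±1`, and its sign does not matter.
    refine exceedOne_congr_abs hd fun i => ?_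
    by_cases hi : i = Fin.last p
    · subst hi
      simp [Function.updateFinset, s, abs_div, div_self hs.ne']
    · simp [Function.updateFinset, hi]
  · intro b hb
    simp only [exceedLast, Set.indicator_apply, Set.mem_ofPred_eq, hb, s, sq_abs]

theorem lmarginal_lastMax_mul_condTail (n : ℕ) (d : ℝ) {v : ℝ≥0} (hv : v ≠ 0)
    (β : Fin (p + 1) → ℝ) {y : Fin (p + 1) → ℝ} (hy : y (Fin.last p) ≠ 0) :
    (∫⋯∫⁻_Finset.univ.erase (Fin.last p),
        (fun b => lastMax b * condTail p n d v |b (Fin.last p)|) ∂(fun i => gaussianReal (β i) v)) y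
      = (∏ l ∈ Finset.univ.erase (Fin.last p),
          gaussianReal (β l) v (Set.Ioo (-|y (Fin.last p)|) |y (Fin.last p)|))
        * condTail p n d v |y (Fin.last p)| := by
  rw [lmarginal_lastMax_mul (fun i => gaussianReal (β i) v)
    (g := fun b => condTail p n d v |b (Fin.last p)|)
    (h := fun _ => condTail p n d v |y (Fin.last p)|) measurable_const hy
    (fun b hb => by rw [hb])]
  have := fun i => isProbabilityMeasure_truncScaled (β i) hv (abs_pos.2 hy)
  congr 1
  rw [lmarginal, lintegral_const, measure_univ, mul_one]

/-- A vanishing last entry is never strictly the largest; this needs a second coordinate. -/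
theorem lastMax_eq_zero (hp : 1 ≤ p) {y : Fin (p + 1) → ℝ} (hy : y (Fin.last p) = 0) :
    lastMax y = 0 := by
  rw [lastMax_eq, Set.indicator_of_notMem]
  intro h
  have := h 0 (by rw [Ne, Fin.ext_iff]; simp; omega)
  rw [hy, abs_zero] at this
  exact absurd (abs_nonneg (y 0)) (not_le.2 this)

theorem lmarginal_lastMax_mul_eq_zero (hp : 1 ≤ p) (μ : Fin (p + 1) → Measure ℝ)
    (g : (Fin (p + 1) → ℝ) → ℝ≥0∞) {y : Fin (p + 1) → ℝ} (hy : y (Fin.last p) = 0) :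
    (∫⋯∫⁻_Finset.univ.erase (Fin.last p), (fun b => lastMax b * g b) ∂μ) y = 0 := by
  rw [lmarginal_congr_fun μ (g := fun _ => 0)]
  · simp [lmarginal]
  · intro b hb
    rw [lastMax_eq_zero hp (by rw [hb _ (by simp), hy]), zero_mul]

/-- Given the largest absolute value, the conditional rejection probability for arbitrary means is at
most that for zero means. -/
theorem lmarginal_exceedLast_le (hp : 1 ≤ p) (n : ℕ) {d : ℝ} (hd : 0 ≤ d) {v : ℝ≥0} (hv : v ≠ 0)
    (β : Fin (p + 1) → ℝ) (y : Fin (p + 1) → ℝ) :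
    (∫⋯∫⁻_Finset.univ.erase (Fin.last p), (fun b => lastMax b * exceedLast n d b)
        ∂(fun i => gaussianReal (β i) v)) y
      ≤ (∫⋯∫⁻_Finset.univ.erase (Fin.last p),
        (fun b => lastMax b * condTail p n d v |b (Fin.last p)|)
          ∂(fun i => gaussianReal (β i) v)) y := by
  by_cases hy : y (Fin.last p) = 0
  · rw [lmarginal_lastMax_mul_eq_zero hp _ _ hy]; exact zero_le
  · rw [lmarginal_lastMax_mul_exceedLast n hd _ hy, lmarginal_lastMax_mul_condTail n d hv β hy,
      condTail, if_pos (abs_pos.2 hy)]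
    gcongr
    exact lmarginal_le_of_absAntitone
      (fun i g hg hga => lintegral_truncScaled_le (β i) hv (abs_pos.2 hy) le_rfl hg hga)
      (measurable_exceedOne n d) (exceedOne_anti hd) _ _

theorem lmarginal_exceedLast_eq (hp : 1 ≤ p) (n : ℕ) {d : ℝ} (hd : 0 ≤ d) {v : ℝ≥0} (hv : v ≠ 0)
    (y : Fin (p + 1) → ℝ) :
    (∫⋯∫⁻_Finset.univ.erase (Fin.last p), (fun b => lastMax b * exceedLast n d b)
        ∂(fun _ => gaussianReal 0 v)) y
      = (∫⋯∫⁻_Finset.univ.erase (Fin.last p),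
        (fun b => lastMax b * condTail p n d v |b (Fin.last p)|)
          ∂(fun _ => gaussianReal 0 v)) y := by
  by_cases hy : y (Fin.last p) = 0
  · rw [lmarginal_lastMax_mul_eq_zero hp _ _ hy, lmarginal_lastMax_mul_eq_zero hp _ _ hy]
  · rw [lmarginal_lastMax_mul_exceedLast n hd _ hy,
      lmarginal_lastMax_mul_condTail n d hv (fun _ => 0) hy, condTail, if_pos (abs_pos.2 hy)]

end Core

/-! ### Comparison with the null coordinates -/

section Cell

variable {k p : ℕ}

/-- The event that `A` is the set of indices of the `|A|` smallest absolute values, and that the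
largest of these is attained at `i ∈ A` only. -/
def cell (i : Fin k) (A : Finset (Fin k)) : Set (Fin k → ℝ) :=
  {b | (∀ l ∈ A, l ≠ i → |b l| < |b i|) ∧ ∀ l ∉ A, |b i| < |b l|}

theorem measurableSet_cell (i : Fin k) (A : Finset (Fin k)) : MeasurableSet (cell i A) := by
  have h : ∀ l l' : Fin k, MeasurableSet {b : Fin k → ℝ | |b l| < |b l'|} := fun l l' =>
    measurableSet_lt (by fun_prop) (by fun_prop)
  have : cell i A = (⋂ l ∈ A, ⋂ (_ : l ≠ i), {b : Fin k → ℝ | |b l| < |b i|})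
      ∩ ⋂ l, ⋂ (_ : l ∉ A), {b : Fin k → ℝ | |b i| < |b l|} := by
    ext b; simp [cell]
  rw [this]
  exact (Finset.measurableSet_biInter _ fun l _ => MeasurableSet.iInter fun _ => h l i).inter
    (MeasurableSet.iInter fun l => MeasurableSet.iInter fun _ => h i l)

/-- Distinct cells of the same size are disjoint: of two such sets of indices of smallest entries one
contains the other, and the largest entry determines `i`. -/
theorem cell_disjoint {i i' : Fin k} {A A' : Finset (Fin k)} (hi : i ∈ A) (hi' : i' ∈ A')
    (hA : A.card = A'.card) (hne : (i, A) ≠ (i', A')) : Disjoint (cell i A) (cell i' A') := by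
  rw [Set.disjoint_left]
  intro b hb hb'
  apply hne
  have aux : ∀ {i i' : Fin k} {A A' : Finset (Fin k)}, i ∈ A → i' ∈ A' → A.card = A'.card →
      b ∈ cell i A → b ∈ cell i' A' → |b i| ≤ |b i'| → (i, A) = (i', A') := by
    intro i i' A A' hi hi' hA hb hb' hle
    have hAA : A = A' := by
      refine Finset.eq_of_subset_of_card_le (fun l hl => ?_) hA.ge
      by_contra hl'
      have h1 := hb'.2 l hl'
      rcases eq_or_ne l i with rfl | hli
      · linarith
      · have := hb.1 l hl hli
        linarith
    subst hAA
    by_contra hii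
    have : i' ≠ i := fun h => hii (by rw [h])
    have := hb.1 i' hi' this
    linarith
  rcases le_total |b i| |b i'| with h | h
  · exact aux hi hi' hA hb hb' h
  · exact (aux hi' hi hA.symm hb' hb h).symm

theorem exists_mem_cell (hk : p + 1 ≤ k) {b : Fin k → ℝ} (hb : Function.Injective fun i => |b i|) :
    ∃ i : Fin k, ∃ A : Finset (Fin k), i ∈ A ∧ A.card = p + 1 ∧ b ∈ cell i A := by
  set τ := Tuple.sort fun i => |b i|
  have hmono : StrictMono ((fun i => |b i|) ∘ τ) :=
    (Tuple.monotone_sort _).strictMono_of_injective (hb.comp τ.injective)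
  let e : Fin (p + 1) ↪ Fin k := (Fin.castLEEmb hk).trans τ.toEmbedding
  refine ⟨e (Fin.last p), Finset.univ.map e, by simp, by simp, ?_, ?_⟩
  · intro l hl hne
    obtain ⟨j, -, rfl⟩ := Finset.mem_map.1 hl
    have hj : j < Fin.last p := lt_of_le_of_ne (Fin.le_last j) fun h => hne (by rw [h])
    exact hmono (show Fin.castLE hk j < Fin.castLE hk (Fin.last p) from hj)
  · intro l hl
    obtain ⟨j, rfl⟩ := τ.surjective l
    refine hmono (show Fin.castLE hk (Fin.last p) < j from ?_)
    by_contra hj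
    refine hl (Finset.mem_map.2 ⟨⟨j, ?_⟩, Finset.mem_univ _, ?_⟩)
    · have : (j : ℕ) ≤ p := by simpa [Fin.le_def] using hj
      omega
    · simp [e]

theorem exists_embedding_last_range {i : Fin k} {A : Finset (Fin k)} (hi : i ∈ A)
    (hA : A.card = p + 1) :
    ∃ e : Fin (p + 1) ↪ Fin k, e (Fin.last p) = i ∧ ∀ l, l ∈ Set.range e ↔ l ∈ A := by
  let f : Fin (p + 1) ≃ A := (A.equivFinOfCardEq hA).symm
  let g : Fin (p + 1) ≃ A := (Equiv.swap (Fin.last p) (f.symm ⟨i, hi⟩)).trans f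
  refine ⟨g.toEmbedding.trans (Function.Embedding.subtype _), by simp [g], fun l => ?_⟩
  constructor
  · rintro ⟨j, rfl⟩
    exact (g j).2
  · intro hl
    exact ⟨g.symm ⟨l, hl⟩, by simp⟩

/-- The indicator of the event that all entries outside the range of `e` are larger in absolute
value than the entry at `e (Fin.last p)`. -/
noncomputable def outsideLarger (e : Fin (p + 1) ↪ Fin k) : (Fin k → ℝ) → ℝ≥0∞ :=
  {b : Fin k → ℝ | ∀ l, l ∉ Set.range e → |b (e (Fin.last p))| < |b l|}.indicator 1

theorem measurable_outsideLarger (e : Fin (p + 1) ↪ Fin k) : Measurable (outsideLarger e) := by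
  refine measurable_const.indicator ?_
  have : {b : Fin k → ℝ | ∀ l, l ∉ Set.range e → |b (e (Fin.last p))| < |b l|}
      = ⋂ l, ⋂ (_ : l ∉ Set.range e), {b | |b (e (Fin.last p))| < |b l|} := by
    ext b; simp
  rw [this]
  exact MeasurableSet.iInter fun l => MeasurableSet.iInter fun _ =>
    measurableSet_lt (by fun_prop) (by fun_prop)

/-- On a cell, a function of the entries in `A` is a function on `Fin (p + 1) → ℝ`, through an
enumeration `e` of `A` that puts `i` last. -/
theorem indicator_cell {e : Fin (p + 1) ↪ Fin k} {i : Fin k} {A : Finset (Fin k)}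
    (hi : e (Fin.last p) = i) (hA : ∀ l, l ∈ Set.range e ↔ l ∈ A)
    {g : (Fin k → ℝ) → ℝ≥0∞} {g' : (Fin (p + 1) → ℝ) → ℝ≥0∞}
    (hg : ∀ b ∈ cell i A, g b = g' (b ∘ e)) (b : Fin k → ℝ) :
    (cell i A).indicator g b = outsideLarger e b * (lastMax (b ∘ e) * g' (b ∘ e)) := by
  subst hi
  have hmem : b ∈ cell (e (Fin.last p)) A ↔
      (b ∘ e ∈ {y : Fin (p + 1) → ℝ | ∀ l, l ≠ Fin.last p → |y l| < |y (Fin.last p)|}) ∧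
      b ∈ {b : Fin k → ℝ | ∀ l, l ∉ Set.range e → |b (e (Fin.last p))| < |b l|} := by
    simp only [cell, ← hA, Set.mem_ofPred_eq, Set.forall_mem_range, Function.comp_apply,
      e.injective.ne_iff, Ne]
  rw [lastMax_eq, outsideLarger]
  by_cases hb : b ∈ cell (e (Fin.last p)) A
  · rw [Set.indicator_of_mem hb, Set.indicator_of_mem (hmem.1 hb).1,
      Set.indicator_of_mem (hmem.1 hb).2, hg b hb]
    simp
  · rw [Set.indicator_of_notMem hb]
    rw [hmem, not_and_or] at hb
    rcases hb with hb | hb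
    · rw [Set.indicator_of_notMem hb]; simp
    · rw [Set.indicator_of_notMem hb]; simp

theorem lmarginal_outsideLarger_mul (μ : Fin k → Measure ℝ) [∀ i, SigmaFinite (μ i)]
    (e : Fin (p + 1) ↪ Fin k) {F : (Fin (p + 1) → ℝ) → ℝ≥0∞} (hF : Measurable F) (x : Fin k → ℝ) :
    (∫⋯∫⁻_(Finset.univ.erase (Fin.last p)).image e, (fun b => outsideLarger e b * F (b ∘ e)) ∂μ) x
      = outsideLarger e x
        * (∫⋯∫⁻_Finset.univ.erase (Fin.last p), F ∂(fun j => μ (e j))) (x ∘ e) := by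
  have h1 := lmarginal_image (μ := μ) e.injective (Finset.univ.erase (Fin.last p)) hF x
  have h2 : (∫⋯∫⁻_(Finset.univ.erase (Fin.last p)).image e,
      (fun b => outsideLarger e b * F (b ∘ e)) ∂μ) x
      = (∫⋯∫⁻_(Finset.univ.erase (Fin.last p)).image e,
      (fun b => outsideLarger e x * F (b ∘ e)) ∂μ) x := by
    refine lmarginal_congr_fun μ fun b hb => ?_
    congr 1
    unfold outsideLarger
    have h0 := hb (e (Fin.last p)) (by simp)
    have hout : ∀ l, l ∉ Set.range e → b l = x l := fun l hl =>
      hb l fun hmem => hl (by obtain ⟨j, -, rfl⟩ := Finset.mem_image.1 hmem; exact ⟨j, rfl⟩)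
    have hiff : (∀ l, l ∉ Set.range e → |b (e (Fin.last p))| < |b l|) ↔
        (∀ l, l ∉ Set.range e → |x (e (Fin.last p))| < |x l|) :=
      forall₂_congr fun l hl => by rw [h0, hout l hl]
    by_cases hx : ∀ l, l ∉ Set.range e → |x (e (Fin.last p))| < |x l|
    · rw [Set.indicator_of_mem (by exact hiff.2 hx), Set.indicator_of_mem (by exact hx)]
      rfl
    · rw [Set.indicator_of_notMem (by exact mt hiff.1 hx), Set.indicator_of_notMem (by exact hx)]
  rw [h2, lmarginal_const_mul_of_measurable μ _ (f := fun b => F (b ∘ e))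
    (hF.comp (by fun_prop))]
  exact congrArg _ h1

/-- The rejection event of the statistic `W n m`, cleared of denominators. -/
def exceedSet (k n m : ℕ) (d : ℝ) : Set (Fin k → ℝ) :=
  {b | d * S n b < n * X b m}

theorem measurableSet_exceedSet (k n m : ℕ) (d : ℝ) : MeasurableSet (exceedSet k n m d) :=
  measurableSet_lt ((measurable_S n).const_mul d) ((measurable_X m).const_mul _)

/-- On a cell, only the entries in `A` contribute to the statistic. -/
theorem X_eq_of_mem_cell {e : Fin (p + 1) ↪ Fin k} {i : Fin k} {A : Finset (Fin k)}
    (hi : e (Fin.last p) = i) (hA : ∀ l, l ∈ Set.range e ↔ l ∈ A) {b : Fin k → ℝ}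
    (hb : b ∈ cell i A) :
    (∀ n ≤ p + 1, S n b = S n (b ∘ e)) ∧ X b (p + 1) = (b ∘ e) (Fin.last p) ^ 2 := by
  subst hi
  have hin : ∀ j, |b (e j)| ≤ |b (e (Fin.last p))| := by
    intro j
    rcases eq_or_ne j (Fin.last p) with rfl | hj
    · exact le_rfl
    · exact (hb.1 _ ((hA _).1 ⟨j, rfl⟩) (e.injective.ne hj)).le
  have hout : ∀ l, l ∉ Set.range e → ∀ j, |b (e j)| ≤ |b l| := fun l hl j =>
    (hin j).trans (hb.2 l (by rwa [← hA])).le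
  refine ⟨fun n hn => (S_comp hn b e hout).symm, ?_⟩
  rw [← X_comp b e hout le_rfl]
  exact orderStat_last (fun i => (b ∘ e) i ^ 2) fun j => sq_le_sq.2 (hin j)

variable {n : ℕ} {d : ℝ} {v : ℝ≥0}

theorem setLIntegral_cell_exceedSet (hn : n ≤ p + 1) (μ : Measure (Fin k → ℝ))
    {e : Fin (p + 1) ↪ Fin k} {i : Fin k} {A : Finset (Fin k)}
    (hi : e (Fin.last p) = i) (hA : ∀ l, l ∈ Set.range e ↔ l ∈ A) :
    ∫⁻ b in cell i A, (exceedSet k n (p + 1) d).indicator 1 b ∂μ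
      = ∫⁻ b, outsideLarger e b * (fun y => lastMax y * exceedLast n d y) (b ∘ e) ∂μ := by
  rw [← lintegral_indicator (measurableSet_cell i A)]
  refine lintegral_congr fun b => indicator_cell (g' := exceedLast n d) hi hA (fun b hb => ?_) b
  obtain ⟨hS, hX⟩ := X_eq_of_mem_cell hi hA hb
  have hiff : b ∈ exceedSet k n (p + 1) d ↔
      b ∘ e ∈ {y : Fin (p + 1) → ℝ | d * S n y < n * y (Fin.last p) ^ 2} := by
    rw [exceedSet, Set.mem_ofPred_eq, hS n hn, hX]
    rfl
  unfold exceedLast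
  by_cases hb' : b ∈ exceedSet k n (p + 1) d
  · rw [Set.indicator_of_mem hb', Set.indicator_of_mem (hiff.1 hb')]
    rfl
  · rw [Set.indicator_of_notMem hb', Set.indicator_of_notMem (mt hiff.2 hb')]

theorem setLIntegral_cell_condTail (μ : Measure (Fin k → ℝ))
    {e : Fin (p + 1) ↪ Fin k} {i : Fin k} {A : Finset (Fin k)}
    (hi : e (Fin.last p) = i) (hA : ∀ l, l ∈ Set.range e ↔ l ∈ A) :
    ∫⁻ b in cell i A, condTail p n d v √(X b (p + 1)) ∂μ
      = ∫⁻ b, outsideLarger e b *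
          (fun y => lastMax y * condTail p n d v |y (Fin.last p)|) (b ∘ e) ∂μ := by
  rw [← lintegral_indicator (measurableSet_cell i A)]
  refine lintegral_congr fun b => indicator_cell
    (g' := fun y => condTail p n d v |y (Fin.last p)|) hi hA (fun b hb => ?_) b
  rw [(X_eq_of_mem_cell hi hA hb).2, Real.sqrt_sq_eq_abs]

theorem measurable_lastMax_mul_exceedLast :
    Measurable fun y : Fin (p + 1) → ℝ => lastMax y * exceedLast n d y :=
  measurable_lastMax.mul (measurable_exceedLast n d)

theorem measurable_lastMax_mul_condTail (hd : 0 ≤ d) (hv : v ≠ 0) :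
    Measurable fun y : Fin (p + 1) → ℝ => lastMax y * condTail p n d v |y (Fin.last p)| :=
  measurable_lastMax.mul ((condTail_mono p n hd hv).measurable.comp (by fun_prop))

theorem measurable_outsideLarger_mul_comp (e : Fin (p + 1) ↪ Fin k)
    {F : (Fin (p + 1) → ℝ) → ℝ≥0∞} (hF : Measurable F) :
    Measurable fun b : Fin k → ℝ => outsideLarger e b * F (b ∘ e) :=
  (measurable_outsideLarger e).mul (hF.comp (by fun_prop))

theorem setLIntegral_cell_le (hp : 1 ≤ p) (hn : n ≤ p + 1) (hd : 0 ≤ d) (hv : v ≠ 0)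
    (β : Fin k → ℝ) {i : Fin k} {A : Finset (Fin k)} (hi : i ∈ A) (hA : A.card = p + 1) :
    ∫⁻ b in cell i A, (exceedSet k n (p + 1) d).indicator 1 b
        ∂(Measure.pi fun i => gaussianReal (β i) v)
      ≤ ∫⁻ b in cell i A, condTail p n d v √(X b (p + 1))
        ∂(Measure.pi fun i => gaussianReal (β i) v) := by
  obtain ⟨e, hei, heA⟩ := exists_embedding_last_range hi hA
  rw [setLIntegral_cell_exceedSet hn _ hei heA, setLIntegral_cell_condTail _ hei heA]
  refine lintegral_le_of_lmarginal_le ((Finset.univ.erase (Fin.last p)).image e)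
    (measurable_outsideLarger_mul_comp e measurable_lastMax_mul_exceedLast)
    (measurable_outsideLarger_mul_comp e (measurable_lastMax_mul_condTail hd hv)) fun x => ?_
  rw [lmarginal_outsideLarger_mul _ e measurable_lastMax_mul_exceedLast,
    lmarginal_outsideLarger_mul _ e (measurable_lastMax_mul_condTail hd hv)]
  gcongr
  exact lmarginal_exceedLast_le hp n hd hv (fun j => β (e j)) _

theorem setLIntegral_cell_eq (hp : 1 ≤ p) (hn : n ≤ p + 1) (hd : 0 ≤ d) (hv : v ≠ 0)
    {i : Fin k} {A : Finset (Fin k)} (hi : i ∈ A) (hA : A.card = p + 1) :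
    ∫⁻ b in cell i A, (exceedSet k n (p + 1) d).indicator 1 b
        ∂(Measure.pi fun _ => gaussianReal 0 v)
      = ∫⁻ b in cell i A, condTail p n d v √(X b (p + 1))
        ∂(Measure.pi fun _ => gaussianReal 0 v) := by
  obtain ⟨e, hei, heA⟩ := exists_embedding_last_range hi hA
  rw [setLIntegral_cell_exceedSet hn _ hei heA, setLIntegral_cell_condTail _ hei heA]
  refine lintegral_eq_of_lmarginal_eq ((Finset.univ.erase (Fin.last p)).image e)
    (measurable_outsideLarger_mul_comp e measurable_lastMax_mul_exceedLast)
    (measurable_outsideLarger_mul_comp e (measurable_lastMax_mul_condTail hd hv))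
    (funext fun x => ?_)
  rw [lmarginal_outsideLarger_mul _ e measurable_lastMax_mul_exceedLast,
    lmarginal_outsideLarger_mul _ e (measurable_lastMax_mul_condTail hd hv),
    lmarginal_exceedLast_eq hp n hd hv]

/-- A nonzero diagonal quadratic form has a null zero set. -/
theorem ae_sum_mul_sq_ne_zero (β : Fin k → ℝ) (hv : v ≠ 0) {c : Fin k → ℝ} {i : Fin k}
    (hi : c i ≠ 0) :
    ∀ᵐ b ∂(Measure.pi fun i => gaussianReal (β i) v), ∑ j, c j * b j ^ 2 ≠ 0 := by
  rw [ae_iff]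
  simp only [ne_eq, not_not]
  have hm : MeasurableSet {b : Fin k → ℝ | ∑ j, c j * b j ^ 2 = 0} :=
    measurableSet_eq_fun (by fun_prop) measurable_const
  rw [← lintegral_indicator_one hm]
  have hnull : NullSingletonClass (gaussianReal (β i) v) := nullSingletonClass_gaussianReal hv
  rw [lintegral_eq_of_lmarginal_eq {i} (g := fun _ => 0) (measurable_one.indicator hm)
    measurable_const, lintegral_zero]
  funext x
  rw [lmarginal_singleton, lmarginal_singleton]
  simp only [lintegral_zero]
  -- With the other coordinates fixed, coordinate `i` has at most two possible values.
  set r := ∑ j ∈ Finset.univ.erase i, c j * x j ^ 2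
  have hset : ∀ t, Function.update x i t ∈ {b : Fin k → ℝ | ∑ j, c j * b j ^ 2 = 0} →
      t ∈ ({√(-r / c i), -√(-r / c i)} : Set ℝ) := by
    intro t ht
    rw [Set.mem_ofPred_eq, ← Finset.add_sum_erase _ _ (Finset.mem_univ i),
      Function.update_self] at ht
    have : ∑ j ∈ Finset.univ.erase i, c j * Function.update x i t j ^ 2 = r :=
      Finset.sum_congr rfl fun j hj => by rw [Function.update_of_ne (Finset.ne_of_mem_erase hj)]
    rw [this] at ht
    have ht2 : t ^ 2 = -r / c i := by field_simp; linarith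
    rw [← ht2, Real.sqrt_sq_eq_abs]
    rcases abs_choice t with h | h <;> simp [h]
  have h0 : ∀ᵐ t ∂(gaussianReal (β i) v), t ∉ ({√(-r / c i), -√(-r / c i)} : Set ℝ) := by
    rw [ae_iff]
    simp only [not_not]
    exact Set.Finite.measure_zero (s := {√(-r / c i), -√(-r / c i)}) (Set.toFinite _) _
  refine lintegral_eq_zero_of_ae_eq_zero ?_
  filter_upwards [h0] with t ht
  exact Set.indicator_of_notMem (fun h => ht (hset t h)) _

theorem ae_injective_abs (β : Fin k → ℝ) (hv : v ≠ 0) :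
    ∀ᵐ b ∂(Measure.pi fun i => gaussianReal (β i) v), Function.Injective fun i => |b i| := by
  have h : ∀ i j : Fin k, i ≠ j →
      ∀ᵐ b ∂(Measure.pi fun i => gaussianReal (β i) v), |b i| ≠ |b j| := by
    intro i j hij
    filter_upwards [ae_sum_mul_sq_ne_zero β hv (c := Pi.single i 1 - Pi.single j 1) (i := i)
      (by simp [hij])] with b hb hbij
    apply hb
    simp [sub_mul, Finset.sum_sub_distrib, Pi.single_apply,
      (sq_eq_sq_iff_abs_eq_abs (b i) (b j)).2 hbij]
  have h' : ∀ᵐ b ∂(Measure.pi fun i => gaussianReal (β i) v), ∀ i j : Fin k, i ≠ j →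
      |b i| ≠ |b j| := by
    simp only [ae_all_iff]
    exact h
  filter_upwards [h'] with b hb i j hij
  by_contra hne
  exact hb i j hne hij

theorem ae_ne_zero (β : Fin k → ℝ) (hv : v ≠ 0) :
    ∀ᵐ b ∂(Measure.pi fun i => gaussianReal (β i) v), ∀ i, b i ≠ 0 := by
  rw [ae_all_iff]
  intro i
  filter_upwards [ae_sum_mul_sq_ne_zero β hv (c := Pi.single i 1) (i := i) (by simp)] with b hb h0
  exact hb (by simp [Pi.single_apply, h0])

/-- The cells of size `p + 1` partition the sample space up to a null set. -/
theorem lintegral_eq_sum_cell (hk : p + 1 ≤ k) (β : Fin k → ℝ) (hv : v ≠ 0)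
    (f : (Fin k → ℝ) → ℝ≥0∞) :
    ∫⁻ b, f b ∂(Measure.pi fun i => gaussianReal (β i) v)
      = ∑ a : Fin k × Finset (Fin k) with a.1 ∈ a.2 ∧ a.2.card = p + 1,
        ∫⁻ b in cell a.1 a.2, f b ∂(Measure.pi fun i => gaussianReal (β i) v) := by
  rw [← lintegral_biUnion_finset]
  · congr 1
    symm
    refine Measure.restrict_eq_self_of_ae_mem ?_
    filter_upwards [ae_injective_abs β hv] with b hb
    obtain ⟨i, A, hi, hA, hmem⟩ := exists_mem_cell hk hb
    simp only [Set.mem_iUnion]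
    exact ⟨(i, A), by simp [hi, hA], hmem⟩
  · intro a ha a' ha' hne
    simp only [Finset.coe_filter, Finset.mem_univ, true_and, Set.mem_ofPred_eq] at ha ha'
    exact cell_disjoint ha.1 ha'.1 (ha.2.trans ha'.2.symm) hne
  · exact fun a _ => measurableSet_cell _ _

/-- The rejection probability is at most the mean of `condTail` at the `m`-th smallest absolute
value. -/
theorem measure_exceedSet_le (hp : 1 ≤ p) (hn : n ≤ p + 1) (hk : p + 1 ≤ k) (hd : 0 ≤ d)
    (hv : v ≠ 0) (β : Fin k → ℝ) :
    (Measure.pi fun i => gaussianReal (β i) v) (exceedSet k n (p + 1) d)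
      ≤ ∫⁻ b, condTail p n d v √(X b (p + 1)) ∂(Measure.pi fun i => gaussianReal (β i) v) := by
  rw [← lintegral_indicator_one (measurableSet_exceedSet _ _ _ _),
    lintegral_eq_sum_cell hk β hv, lintegral_eq_sum_cell hk β hv]
  refine Finset.sum_le_sum fun a ha => ?_
  simp only [Finset.mem_filter, Finset.mem_univ, true_and] at ha
  exact setLIntegral_cell_le hp hn hd hv β ha.1 ha.2

/-- The same comparison is an equality when all means vanish. -/
theorem measure_exceedSet_null (hp : 1 ≤ p) (hn : n ≤ p + 1) (hk : p + 1 ≤ k) (hd : 0 ≤ d)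
    (hv : v ≠ 0) :
    (Measure.pi fun _ : Fin k => gaussianReal 0 v) (exceedSet k n (p + 1) d)
      = ∫⁻ b, condTail p n d v √(X b (p + 1)) ∂(Measure.pi fun _ : Fin k => gaussianReal 0 v) := by
  rw [← lintegral_indicator_one (measurableSet_exceedSet _ _ _ _),
    lintegral_eq_sum_cell hk (fun _ => 0) hv, lintegral_eq_sum_cell hk (fun _ => 0) hv]
  refine Finset.sum_congr rfl fun a ha => ?_
  simp only [Finset.mem_filter, Finset.mem_univ, true_and] at ha
  exact setLIntegral_cell_eq hp hn hd hv ha.1 ha.2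

theorem map_comp_embedding (μ : Fin k → Measure ℝ) [∀ i, IsProbabilityMeasure (μ i)] {m : ℕ}
    (e : Fin m ↪ Fin k) :
    (Measure.pi μ).map (fun b => b ∘ e) = Measure.pi fun j => μ (e j) := by
  have h : iIndepFun (fun (i : Fin k) (b : Fin k → ℝ) => b i) (Measure.pi μ) :=
    iIndepFun_pi (X := fun _ => id) fun i => aemeasurable_id
  have h' := (iIndepFun_iff_map_fun_eq_pi_map (fun i => (measurable_pi_apply (e i)).aemeasurable)).1
    (h.precomp e.injective)
  have hmap : ∀ i, (Measure.pi μ).map (fun b : Fin k → ℝ => b i) = μ i := fun i =>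
    (measurePreserving_eval μ i).map_eq
  simp only [hmap] at h'
  exact h'

/-- Under the null hypothesis, the rejection probability is at most that of the `m`
null coordinates alone. -/
theorem measure_exceedSet_le_null (hp : 1 ≤ p) (hn : n ≤ p + 1) (hd : 0 ≤ d)
    (hv : v ≠ 0) (β : Fin k → ℝ) (e : Fin (p + 1) ↪ Fin k) (he : ∀ j, β (e j) = 0) :
    (Measure.pi fun i => gaussianReal (β i) v) (exceedSet k n (p + 1) d)
      ≤ (Measure.pi fun _ : Fin (p + 1) => gaussianReal 0 v) (exceedSet (p + 1) n (p + 1) d) := by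
  have hk : p + 1 ≤ k := by simpa using Fintype.card_le_of_embedding e
  have hmono := condTail_mono p n hd hv
  refine (measure_exceedSet_le hp hn hk hd hv β).trans ?_
  rw [measure_exceedSet_null hp hn le_rfl hd hv]
  have hmap := map_comp_embedding (fun i => gaussianReal (β i) v) e
  simp only [he] at hmap
  rw [← hmap, lintegral_map (f := fun y : Fin (p + 1) → ℝ => condTail p n d v √(X y (p + 1)))
    (hmono.measurable.comp (measurable_X (p + 1)).sqrt) (by fun_prop)]
  exact lintegral_mono fun b => hmono <| Real.sqrt_le_sqrt <|
    orderStat_le_comp (fun i => b i ^ 2) e (by omega) le_rfl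

end Cell

/-! ### Percentiles and the level of the test -/

section Level

variable {k p n : ℕ} {d σ : ℝ}

theorem variance_ne_zero (hσ : 0 < σ) : (σ ^ 2).toNNReal ≠ 0 :=
  (Real.toNNReal_pos.2 (by positivity)).ne'

instance (β : Fin k → ℝ) (σ : ℝ) : IsProbabilityMeasure (effectLaw β σ) := by
  unfold effectLaw; infer_instance

/-- Clearing the denominator in `W n m b > d` is harmless, as `S n b` vanishes with probability
zero only. -/
theorem measure_W_gt {m : ℕ} (hn1 : 1 ≤ n) (hnk : n ≤ k) (hσ : 0 < σ) (β : Fin k → ℝ) :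
    effectLaw β σ {b | W n m b > d} = effectLaw β σ (exceedSet k n m d) := by
  refine measure_congr ?_
  filter_upwards [ae_ne_zero β (variance_ne_zero hσ)] with b hb
  exact propext (lt_div_iff₀ (S_pos hn1 hnk hb))

theorem effectLaw_zero_eq_map (σ : ℝ) :
    effectLaw (0 : Fin k → ℝ) σ = (effectLaw (0 : Fin k → ℝ) 1).map fun y i => σ * y i := by
  have hg : (gaussianReal 0 ((1 : ℝ) ^ 2).toNNReal).map (σ * ·)
      = gaussianReal 0 (σ ^ 2).toNNReal := by
    rw [gaussianReal_map_const_mul, mul_zero]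
    congr 1
    ext
    simp [Real.coe_toNNReal _ (sq_nonneg σ)]
  unfold effectLaw
  simp only [Pi.zero_apply]
  have : SigmaFinite ((gaussianReal 0 ((1 : ℝ) ^ 2).toNNReal).map (σ * ·)) := by
    rw [hg]; infer_instance
  rw [Measure.pi_map_pi (f := fun _ => (σ * ·)) fun _ => by fun_prop, hg]

theorem effectLaw_eq_map_add (β : Fin k → ℝ) (σ : ℝ) :
    effectLaw β σ = (effectLaw (0 : Fin k → ℝ) σ).map fun z i => z i + β i := by
  unfold effectLaw
  have hg : ∀ i, (gaussianReal 0 (σ ^ 2).toNNReal).map (· + β i)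
      = gaussianReal (β i) (σ ^ 2).toNNReal := fun i => by
    rw [gaussianReal_map_add_const, zero_add]
  have : ∀ i, SigmaFinite ((gaussianReal 0 (σ ^ 2).toNNReal).map (· + β i)) := fun i => by
    rw [hg]; infer_instance
  simp only [Pi.zero_apply]
  rw [Measure.pi_map_pi (f := fun i => (· + β i)) fun _ => by fun_prop]
  simp only [hg]

/-- The statistic is scale invariant, so its null distribution is free of `σ`. -/
theorem null_prob_eq (m n : ℕ) (hσ : 0 < σ) (d : ℝ) :
    (effectLaw (0 : Fin m → ℝ) σ).real {y | Z n y > d}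
      = (effectLaw (0 : Fin m → ℝ) 1).real {y | Z n y > d} := by
  have hmeas : MeasurableSet {y : Fin m → ℝ | Z n y > d} :=
    measurableSet_lt measurable_const (measurable_W n m)
  rw [effectLaw_zero_eq_map σ, map_measureReal_apply (by fun_prop) hmeas]
  congr 1
  ext y
  simp only [Set.mem_preimage, Set.mem_ofPred_eq, Z_eq_W, W_smul n m y hσ.ne']

theorem S_eq_sum_sort {m : ℕ} (hn : n ≤ m) (y : Fin m → ℝ) :
    S n y = ∑ j : Fin m, if (j : ℕ) < n then y (Tuple.sort (fun i => y i ^ 2) j) ^ 2 else 0 := by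
  have h1 : S n y = ∑ j ∈ Finset.range n, X y (j + 1) := by
    rw [S, Finset.range_eq_Ico, Finset.sum_Ico_add' (fun j => X y j) 0 n 1]
    rfl
  have h2 : ∀ j : Fin m, (if (j : ℕ) < n then y (Tuple.sort (fun i => y i ^ 2) j) ^ 2 else 0)
      = if (j : ℕ) < n then X y (j + 1) else 0 := by
    intro j
    rw [X, exists_eq_orderStat _ (by omega) (by omega)]
    rfl
  rw [h1, Finset.sum_congr rfl fun j _ => h2 j,
    Fin.sum_univ_eq_sum_range (fun j => if j < n then X y (j + 1) else 0) m, ← Finset.sum_filter]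
  refine Finset.sum_congr ?_ fun _ _ => rfl
  ext j
  simp only [Finset.mem_range, Finset.mem_filter]
  omega

/-- The law of `Z` has no atoms. -/
theorem ae_Z_ne (hp : 1 ≤ p) (hn1 : 1 ≤ n) (hn : n ≤ p + 1) (d : ℝ) :
    ∀ᵐ y ∂(effectLaw (0 : Fin (p + 1) → ℝ) 1), Z n y ≠ d := by
  have hv := variance_ne_zero one_pos
  -- When `τ` sorts the squares, `n * X y (p + 1) - d * S n y` is the diagonal quadratic form with
  -- coefficients `c τ`. It is nonzero: at the largest entry the coefficient is `n` or `n - d`, and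
  -- for `n = d = p + 1` the coefficient at the smallest entry is `-d`.
  set c : Equiv.Perm (Fin (p + 1)) → Fin (p + 1) → ℝ := fun τ l =>
    (if τ.symm l = Fin.last p then (n : ℝ) else 0) - d * if (τ.symm l : ℕ) < n then 1 else 0
  have hc : ∀ τ, ∃ l, c τ l ≠ 0 := by
    intro τ
    have hn0 : (n : ℝ) ≠ 0 := by positivity
    rcases hn.lt_or_eq with hlt | heq
    · refine ⟨τ (Fin.last p), ?_⟩
      have : ¬ p < n := by omega
      simpa [c, this] using hn0
    · by_cases hd : d = n
      · refine ⟨τ 0, ?_⟩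
        have h0 : (0 : Fin (p + 1)) ≠ Fin.last p := by
          rw [Ne, Fin.ext_iff]; simp; omega
        have h1 : 0 < n := hn1
        simpa [c, h0, h1, hd] using hn0
      · refine ⟨τ (Fin.last p), ?_⟩
        have : p < n := by omega
        simpa [c, this, sub_eq_zero] using fun h => hd h.symm
  have hae : ∀ᵐ y ∂(effectLaw (0 : Fin (p + 1) → ℝ) 1), ∀ τ, ∑ l, c τ l * y l ^ 2 ≠ 0 := by
    rw [ae_all_iff]
    intro τ
    obtain ⟨l, hl⟩ := hc τ
    exact ae_sum_mul_sq_ne_zero 0 hv hl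
  filter_upwards [hae, ae_ne_zero 0 hv] with y hy hy0 hZ
  refine hy (Tuple.sort fun i => y i ^ 2) ?_
  rw [Z_eq_W, W, div_eq_iff (S_pos hn1 hn hy0).ne', S_eq_sum_sort hn, X,
    exists_eq_orderStat _ (by omega) le_rfl] at hZ
  rw [← Equiv.sum_comp (Tuple.sort fun i => y i ^ 2)]
  simp only [c, Equiv.symm_apply_apply, sub_mul, Finset.sum_sub_distrib, ite_mul, zero_mul,
    Finset.sum_ite_eq', Finset.mem_univ, if_true]
  rw [sub_eq_zero]
  refine hZ.trans ?_
  rw [Finset.mul_sum]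
  refine Finset.sum_congr rfl fun j _ => ?_
  split_ifs <;> simp

theorem exists_isUpperPercentile (hp : 1 ≤ p) (hn1 : 1 ≤ n) (hn : n ≤ p + 1) {α : ℝ}
    (hα0 : 0 < α) (hα1 : α < 1) : ∃ d, IsUpperPercentile n (p + 1) α d := by
  have hZ : Measurable (Z n : (Fin (p + 1) → ℝ) → ℝ) := measurable_W n (p + 1)
  set ν := (effectLaw (0 : Fin (p + 1) → ℝ) 1).map (Z n)
  have : IsProbabilityMeasure ν := Measure.isProbabilityMeasure_map hZ.aemeasurable
  have hatom : ∀ d, ν {d} = 0 := by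
    intro d
    rw [Measure.map_apply hZ (measurableSet_singleton d)]
    have h := ae_Z_ne hp hn1 hn d
    rw [ae_iff] at h
    simp only [ne_eq, not_not] at h
    exact h
  have hcont : Continuous (cdf ν) := by
    rw [continuous_iff_continuousAt]
    intro d
    rw [(cdf ν).mono.continuousAt_iff_leftLim_eq_rightLim, StieltjesFunction.rightLim_eq]
    refine le_antisymm ((cdf ν).mono.leftLim_le le_rfl) ?_
    have h := (cdf ν).measure_singleton d
    rw [measure_cdf, hatom, eq_comm, ENNReal.ofReal_eq_zero] at h
    linarith
  obtain ⟨a, ha⟩ := ((tendsto_cdf_atBot ν).eventually_le_const (u := 1 - α) (by linarith)).exists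
  obtain ⟨b, hb⟩ := ((tendsto_cdf_atTop ν).eventually_const_le (u := 1 - α) (by linarith)).exists
  obtain ⟨d, hd⟩ := mem_range_of_exists_le_of_exists_ge hcont ⟨a, ha⟩ ⟨b, hb⟩
  refine ⟨d, ?_⟩
  rw [cdf_eq_real] at hd
  have h1 : (effectLaw (0 : Fin (p + 1) → ℝ) 1).real {y | Z n y > d} = ν.real (Set.Ioi d) :=
    (map_measureReal_apply hZ measurableSet_Ioi).symm
  rw [IsUpperPercentile, h1, ← Set.compl_Iic, probReal_compl_eq_one_sub measurableSet_Iic, hd]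
  ring

/-- As `Z` is nonnegative, its tail probability at a negative number is `1`. -/
theorem IsUpperPercentile.nonneg {m : ℕ} {α : ℝ} (hα1 : α < 1)
    (h : IsUpperPercentile n m α d) : 0 ≤ d := by
  by_contra hd
  have huniv : {y : Fin m → ℝ | Z n y > d} = Set.univ :=
    Set.eq_univ_of_forall fun y => (not_le.1 hd).trans_le (W_nonneg n m y)
  rw [IsUpperPercentile, huniv, probReal_univ] at h
  linarith

theorem exists_embedding_of_mem_H0 {m : ℕ} {β : Fin k → ℝ} (hβ : β ∈ H0 k m) :
    ∃ e : Fin m ↪ Fin k, ∀ j, β (e j) = 0 := by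
  have hcard : Fintype.card (Fin m) ≤ Fintype.card {i // β i = 0} := by
    rw [Fintype.card_fin, Fintype.card_subtype]
    exact hβ
  obtain ⟨f⟩ := Function.Embedding.nonempty_of_card_le hcard
  exact ⟨f.trans (Function.Embedding.subtype _), fun j => (f j).2⟩

theorem mem_H0_of_embedding {m : ℕ} {β : Fin k → ℝ} (e : Fin m ↪ Fin k)
    (he : ∀ j, β (e j) = 0) : β ∈ H0 k m := by
  have : (Finset.univ.map e).card ≤ numZero β := by
    refine Finset.card_le_card fun i hi => ?_
    obtain ⟨j, -, rfl⟩ := Finset.mem_map.1 hi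
    simp [he]
  simpa [H0] using this

/-- The effects that vanish on the range of `e` and equal `t` elsewhere. -/
noncomputable def farEffects {m : ℕ} (e : Fin m ↪ Fin k) (t : ℝ) (i : Fin k) : ℝ :=
  open Classical in if i ∈ Set.range e then 0 else t

theorem farEffects_apply {m : ℕ} (e : Fin m ↪ Fin k) (t : ℝ) (j : Fin m) :
    farEffects e t (e j) = 0 := by
  simp [farEffects]

/-- When the nonzero effects tend to infinity, the rejection probability tends to that of the `m`
null coordinates alone. -/
theorem tendsto_effectLaw_farEffects {m : ℕ} (hn : n ≤ m) (e : Fin m ↪ Fin k) (σ d : ℝ) :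
    Filter.Tendsto (fun N : ℕ => (effectLaw (farEffects e N) σ).real {b | W n m b > d})
      Filter.atTop (nhds ((effectLaw (0 : Fin m → ℝ) σ).real {y | Z n y > d})) := by
  have hmeas : MeasurableSet {b : Fin k → ℝ | W n m b > d} :=
    measurableSet_lt measurable_const (measurable_W n m)
  have hmeas' : MeasurableSet {y : Fin m → ℝ | Z n y > d} :=
    measurableSet_lt measurable_const (measurable_W n m)
  have hadd : ∀ t : ℝ, Measurable fun (z : Fin k → ℝ) i => z i + farEffects e t i := fun t => by
    fun_prop
  have hcomp : Measurable fun z : Fin k → ℝ => z ∘ e := by fun_prop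
  have hmap : (effectLaw (0 : Fin k → ℝ) σ).map (fun z => z ∘ e) = effectLaw (0 : Fin m → ℝ) σ :=
    map_comp_embedding (fun i => gaussianReal ((0 : Fin k → ℝ) i) (σ ^ 2).toNNReal) e
  rw [← hmap]
  simp only [measureReal_def]
  refine (ENNReal.tendsto_toReal (measure_ne_top _ _)).comp ?_
  have hN : ∀ N : ℕ, effectLaw (farEffects e N) σ {b | W n m b > d}
      = effectLaw 0 σ ((fun z i => z i + farEffects e N i) ⁻¹' {b | W n m b > d}) := fun N => by
    rw [effectLaw_eq_map_add, Measure.map_apply (hadd N) hmeas]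
  simp only [hN]
  rw [Measure.map_apply hcomp hmeas']
  refine tendsto_measure_of_ae_tendsto_indicator_of_isFiniteMeasure _ (hcomp hmeas')
    (fun N => hadd N hmeas) (Filter.Eventually.of_forall fun z => ?_)
  have hlarge : ∀ᶠ N : ℕ in Filter.atTop, ∀ l i, |z (e i)| + |z l| ≤ (N : ℝ) := by
    rw [Filter.eventually_all]
    intro l
    rw [Filter.eventually_all]
    intro i
    exact tendsto_natCast_atTop_atTop.eventually_ge_atTop _
  -- Once the entries off the range of `e` exceed all others, they do not enter the statistic.
  filter_upwards [hlarge] with N hN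
  have hW := W_comp hn (fun i => z i + farEffects e N i) e (fun l hl i => by
    have h1 : farEffects e N l = N := by simp only [farEffects, if_neg hl]
    rw [farEffects_apply, h1, add_zero]
    have h2 := hN l i
    have h3 := neg_abs_le (z l)
    exact (by linarith : |z (e i)| ≤ z l + N).trans (le_abs_self _))
  have he : (fun i => z i + farEffects e N i) ∘ e = z ∘ e := by
    funext j
    simp [farEffects_apply]
  rw [he] at hW
  simp only [Set.mem_preimage, Set.mem_ofPred_eq, Z_eq_W, hW]

theorem isLevelTest (hp : 1 ≤ p) (hn1 : 1 ≤ n) (hn : n ≤ p + 1) (hk : p + 1 ≤ k) {α : ℝ}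
    (hα1 : α < 1) (hd : IsUpperPercentile n (p + 1) α d) :
    IsLevelTest (H0 k (p + 1)) (R k n (p + 1) d) α := by
  have hd0 := hd.nonneg hα1
  refine ⟨measurableSet_lt measurable_const (measurable_W n (p + 1)), fun σ hσ => ⟨?_, ?_⟩⟩
  · rintro _ ⟨β, hβ, rfl⟩
    obtain ⟨e, he⟩ := exists_embedding_of_mem_H0 hβ
    have h := measure_exceedSet_le_null hp hn hd0 (variance_ne_zero hσ) β e he
    rw [← hd, ← null_prob_eq (p + 1) n hσ d]
    refine ENNReal.toReal_mono (measure_ne_top _ _) ?_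
    refine (measure_W_gt hn1 (hn.trans hk) hσ β).trans_le (h.trans_eq ?_)
    exact (measure_W_gt hn1 hn hσ 0).symm
  · intro u hu
    have htend := tendsto_effectLaw_farEffects hn (Fin.castLEEmb hk) σ d
    rw [null_prob_eq (p + 1) n hσ d, hd] at htend
    exact le_of_tendsto' htend fun N => hu ⟨_, mem_H0_of_embedding _ (farEffects_apply _ _), rfl⟩

end Level

end StepUp

/-- For `1 ≤ ν < m ≤ k`, `ν ≤ n ≤ m` and `0 < α < 1`: the law of `Z_{n,m}` is free of the nuisance
parameter, it has an upper-`α` percentile, and with such a percentile `d` the region `{W_{n,m} > d}`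
is a level-`α` test of `H_{0,m}`. In particular this holds for fixed scaling `n = ν` and, with its own
percentile, for sequential scaling `n = m - 1`. -/
theorem theorem2 (k ν m : ℕ) (hν : 1 ≤ ν) (hνm : ν + 1 ≤ m) (hmk : m ≤ k)
    (α : ℝ) (hα0 : 0 < α) (hα1 : α < 1) :
    (∀ n : ℕ, ν ≤ n → n ≤ m →
      (∀ σ : ℝ, 0 < σ → ∀ d : ℝ,
        (StepUp.effectLaw (0 : Fin m → ℝ) σ).real {y | StepUp.Z n y > d} =
          (StepUp.effectLaw (0 : Fin m → ℝ) 1).real {y | StepUp.Z n y > d}) ∧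
      (∃ d : ℝ, StepUp.IsUpperPercentile n m α d) ∧
      ∀ d : ℝ, StepUp.IsUpperPercentile n m α d →
        StepUp.IsLevelTest (StepUp.H0 k m) (StepUp.R k n m d) α) ∧
    (∀ dfix : ℝ, StepUp.IsUpperPercentile ν m α dfix →
      StepUp.IsLevelTest (StepUp.H0 k m) (StepUp.R k ν m dfix) α) ∧
    (∀ dseq : ℝ, StepUp.IsUpperPercentile (m - 1) m α dseq →
      StepUp.IsLevelTest (StepUp.H0 k m) (StepUp.R k (m - 1) m dseq) α) := by
  obtain ⟨p, rfl⟩ : ∃ p, m = p + 1 := ⟨m - 1, by omega⟩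
  have key : ∀ n, ν ≤ n → n ≤ p + 1 → ∀ d, StepUp.IsUpperPercentile n (p + 1) α d →
      StepUp.IsLevelTest (StepUp.H0 k (p + 1)) (StepUp.R k n (p + 1) d) α := fun n h1 h2 _ hd =>
    StepUp.isLevelTest (by omega) (hν.trans h1) h2 hmk hα1 hd
  exact ⟨fun n h1 h2 => ⟨fun σ hσ d => StepUp.null_prob_eq (p + 1) n hσ d,
      StepUp.exists_isUpperPercentile (by omega) (hν.trans h1) h2 hα0 hα1, key n h1 h2⟩,
    key ν le_rfl (by omega), key (p + 1 - 1) (by omega) (by omega)⟩
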